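/- All vector spaces are over $\mathbb{C}$, and vector superspaces are $\mathbb{Z}/2$-graded. Let $\bar{\mathfrak{s}}$ be the Lie superalgebra with even basis vectors $L_n$ and odd basis vectors $G_n$ ($n\in\mathbb{Z}$) and brackets $$[L_m,L_n]=(n-m)L_{m+n},\qquad [L_m,G_p]=\left(p-\tfrac m2\right)G_{p+m},\qquad [G_p,G_q]=-2L_{p+q}$$ (the quotient of the $N=1$ Ramond algebra by its central element). Let $A=\mathbb{C}[t^{\pm1}]\otimes\Lambda(1)$, where $\Lambda(1)$ is the Grassmann algebra in one odd variable $\xi$, and let $\bar{\mathfrak{s}}$ act on $A$ by $$L_n\circ x=t^{n+1}\partial_t(x)+\tfrac n2t^n\xi\partial_\xi(x),\qquad G_n\circ x=t^{n+1}\xi\partial_t(x)-t^n\partial_\xi(x).$$ Let $\widetilde{\mathfrak{s}}=\bar{\mathfrak{s}}\ltimes A$ be the Lie superalgebra in which $A$ is an abelian ideal and $[x,y]=x\circ y$ for $x\in\bar{\mathfrak{s}}$, $y\in A$. An $A\bar{\mathfrak{s}}$-module is a ($\mathbb{Z}/2$-graded) $\widetilde{\mathfrak{s}}$-module on which $A$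 acts as a unital associative algebra. It is simple if it is nonzero and has no $\mathbb{Z}/2$-graded submodules other than $0$ and itself. It is cuspidal if $L_0$ acts diagonalizably and there is $N\in\mathbb{N}$ such that every eigenspace of $L_0$ has dimension less than $N$. For $\lambda,b\in\mathbb{C}$ let $\Gamma(\lambda,b)=A\otimes\mathbb{C}u$, where $u$ is a homogeneous vector of either parity, be the $A\bar{\mathfrak{s}}$-module with the actions $$\begin{aligned} t^i\xi^r.(y\otimes u)&=t^i\xi^ry\otimes u,\\ L_m.(t^i\xi^r\otimes u)&=\left(\lambda+i+m\left(b+\tfrac12\delta_{1,r}\right)\right)t^{m+i}\xi^r\otimes u,\\ G_m.(t^i\otimes u)&=(\lambda+i+2mb)\,t^{m+i}\xi\otimes u,\\ G_m.(t^i\xi\otimes u)&=-t^{m+i}\otimes u, \end{aligned}$$ where $i,m\in\mathbb{Z}$, $r\in\{0,1\}$, $y\in A$. **Statement.** Every simple cuspidal $A\bar{\mathfrak{s}}$-module is isomorphic, by a parity-preserving isomorphism of $A\bar{\mathfrak{s}}$-modules, to $\Gamma(\lambda,b)$ for some $\lambda,b\in\mathbb{C}$ and some parity of $u$. -/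

import Mathlib

open scoped LaurentPolynomial

set_option linter.unusedSimpArgs false
set_option linter.unnecessarySeqFocus false
set_option linter.unreachableTactic false
set_option linter.unusedTactic false

noncomputable section

namespace Ramond

/-! ### Superspaces, Lie superalgebras and their modules (over `ℂ`) -/

/-- A structure of vector superspace `V = V₀ ⊕ V₁` on a complex vector space `V`. -/
structure Superspace (V : Type*) [AddCommGroup V] [Module ℂ V] where
  /-- the homogeneous subspaces -/
  gr : ZMod 2 → Submodule ℂ V
  isCompl : IsCompl (gr 0) (gr 1)

/-- The sign `(-1)^{ij}` for parities `i, j`. -/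
def sgn (i j : ZMod 2) : ℂ := if i = 1 ∧ j = 1 then -1 else 1

/-- The projection of a superspace onto its odd part along its even part. -/
def Superspace.oddPart {V : Type*} [AddCommGroup V] [Module ℂ V] (S : Superspace V) :
    V →ₗ[ℂ] V :=
  (S.gr 1).projection (S.gr 0) S.isCompl.symm

/-- A structure of Lie superalgebra on a complex vector space `g`. -/
structure LieSuperalgebra (g : Type*) [AddCommGroup g] [Module ℂ g] extends Superspace g where
  bracket : g →ₗ[ℂ] g →ₗ[ℂ] g
  bracket_mem : ∀ i j x y, x ∈ gr i → y ∈ gr j → bracket x y ∈ gr (i + j)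
  skew : ∀ i j x y, x ∈ gr i → y ∈ gr j → bracket x y = -(sgn i j • bracket y x)
  jacobi : ∀ i j k x y z, x ∈ gr i → y ∈ gr j → z ∈ gr k →
    bracket x (bracket y z) = bracket (bracket x y) z + sgn i j • bracket y (bracket x z)

/-- A module over a Lie superalgebra: a superspace `M` with an even linear map
`act : g → End M` with `[x, y] v = x (y v) - (-1)^{|x||y|} y (x v)` for homogeneous `x`, `y`. -/
structure SuperModule {g : Type*} [AddCommGroup g] [Module ℂ g] (L : LieSuperalgebra g)
    (M : Type*) [AddCommGroup M] [Module ℂ M] extends Superspace M where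
  act : g →ₗ[ℂ] Module.End ℂ M
  act_mem : ∀ i j x v, x ∈ L.gr i → v ∈ gr j → act x v ∈ gr (i + j)
  act_bracket : ∀ i j x y v, x ∈ L.gr i → y ∈ L.gr j →
    act (L.bracket x y) v = act x (act y v) - sgn i j • act y (act x v)

namespace SuperModule

variable {g : Type*} [AddCommGroup g] [Module ℂ g] {L : LieSuperalgebra g}
  {M : Type*} [AddCommGroup M] [Module ℂ M] {N : Type*} [AddCommGroup N] [Module ℂ N]

/-- `M` is simple: it is nonzero, and `0` and `M` are its only submodules, where a submodule is
a `ℤ/2`-graded subspace that is stable under the action. -/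
def IsSimple (ρ : SuperModule L M) : Prop :=
  Nontrivial M ∧ ∀ W : Submodule ℂ M,
    (∀ x, ∀ w ∈ W, ρ.act x w ∈ W) → W = (W ⊓ ρ.gr 0) ⊔ (W ⊓ ρ.gr 1) → W = ⊥ ∨ W = ⊤

/-- `M` and `N` are isomorphic: there is a parity-preserving bijective intertwining map. -/
def IsIsomorphic (ρ : SuperModule L M) (σ : SuperModule L N) : Prop :=
  ∃ f : M ≃ₗ[ℂ] N, (∀ i, ∀ v ∈ ρ.gr i, f v ∈ σ.gr i) ∧ ∀ x v, f (ρ.act x v) = σ.act x (f v)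

end SuperModule

/-! #### Semidirect products with abelian ideals -/

section Semidirect

lemma Superspace.oddPart_of_mem {V : Type*} [AddCommGroup V] [Module ℂ V] (S : Superspace V)
    {i : ZMod 2} {x : V} (hx : x ∈ S.gr i) : S.oddPart x = if i = 1 then x else 0 := by
  have hz2 : ∀ m : ZMod 2, m = 0 ∨ m = 1 := by decide
  obtain rfl | rfl := hz2 i
  · simpa [Superspace.oddPart] using hx
  · rw [if_pos rfl]
    exact Submodule.projection_apply_of_mem_left _ hx

variable {g : Type*} [AddCommGroup g] [Module ℂ g] (L : LieSuperalgebra g)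
  {N : Type*} [AddCommGroup N] [Module ℂ N] (ρ : SuperModule L N)

/-- The bilinear map `(x, y) ↦ (-1)^{|a||y|} y a` for homogeneous `a`, `y`. -/
def signedAct : N →ₗ[ℂ] g →ₗ[ℂ] N :=
  ρ.act.flip - (2 : ℂ) • (ρ.act.flip.compl₁₂ ρ.oddPart L.oddPart)

lemma signedAct_apply {i j : ZMod 2} {a : N} {y : g} (ha : a ∈ ρ.gr i) (hy : y ∈ L.gr j) :
    signedAct L ρ a y = sgn i j • ρ.act y a := by
  simp only [signedAct, LinearMap.sub_apply, LinearMap.smul_apply, LinearMap.compl₁₂_apply,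
    LinearMap.flip_apply, ρ.oddPart_of_mem ha, L.oddPart_of_mem hy, sgn]
  by_cases h1 : i = 1 <;> by_cases h2 : j = 1 <;> simp [h1, h2]
  module

/-- The bracket `[(x, a), (y, b)] = ([x, y], x b - (-1)^{|a||y|} y a)`. -/
def semidirectBracket : (g × N) →ₗ[ℂ] (g × N) →ₗ[ℂ] (g × N) :=
  LinearMap.mk₂ ℂ
    (fun p q => (L.bracket p.1 q.1, ρ.act p.1 q.2 - signedAct L ρ p.2 q.1))
    (by intros; ext <;> simp; abel) (by intros; ext <;> simp [smul_sub])
    (by intros; ext <;> simp; abel) (by intros; ext <;> simp [smul_sub])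

/-- The semidirect product `g ⋉ N` of a Lie superalgebra with a module, viewed as an abelian
ideal. -/
def semidirect : LieSuperalgebra (g × N) where
  gr i := (L.gr i).prod (ρ.gr i)
  isCompl := by
    have h1 := L.isCompl
    have h2 := ρ.isCompl
    constructor
    · rw [disjoint_iff, Submodule.prod_inf_prod, h1.inf_eq_bot, h2.inf_eq_bot,
        Submodule.prod_bot]
    · rw [codisjoint_iff, Submodule.prod_sup_prod, h1.sup_eq_top, h2.sup_eq_top,
        Submodule.prod_top]
  bracket := semidirectBracket L ρ
  bracket_mem := by
    rintro i j ⟨x, a⟩ ⟨y, b⟩ ⟨hx, ha⟩ ⟨hy, hb⟩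
    refine ⟨L.bracket_mem _ _ _ _ hx hy, ?_⟩
    simp only [semidirectBracket, LinearMap.mk₂_apply]
    rw [signedAct_apply L ρ ha hy]
    exact sub_mem (ρ.act_mem _ _ _ _ hx hb)
      (Submodule.smul_mem _ _ (add_comm j i ▸ ρ.act_mem _ _ _ _ hy ha))
  skew := by
    rintro i j ⟨x, a⟩ ⟨y, b⟩ ⟨hx, ha⟩ ⟨hy, hb⟩
    simp only [semidirectBracket, LinearMap.mk₂_apply]
    rw [signedAct_apply L ρ ha hy, signedAct_apply L ρ hb hx, L.skew _ _ _ _ hx hy]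
    have : sgn j i = sgn i j := by simp [sgn, and_comm]
    have h2 : sgn i j * sgn i j = 1 := by unfold sgn; split_ifs <;> norm_num
    ext
    · simp
    · simp [smul_sub, this, smul_smul, h2]
  jacobi := by
    rintro i j k ⟨x, a⟩ ⟨y, b⟩ ⟨z, c⟩ ⟨hx, ha⟩ ⟨hy, hb⟩ ⟨hz, hc⟩
    simp only [semidirectBracket, LinearMap.mk₂_apply]
    have hxy := L.bracket_mem _ _ _ _ hx hy
    have hyz := L.bracket_mem _ _ _ _ hy hz
    have hxz := L.bracket_mem _ _ _ _ hx hz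
    have e1 := ρ.act_mem _ _ _ _ hx hb
    have e2 := add_comm j i ▸ ρ.act_mem _ _ _ _ hy ha
    ext
    · simpa using L.jacobi _ _ _ _ _ _ hx hy hz
    · simp only [map_sub, map_smul, LinearMap.sub_apply, LinearMap.smul_apply, Prod.snd_add,
        Prod.smul_snd, signedAct_apply L ρ ha hyz, signedAct_apply L ρ hb hz,
        signedAct_apply L ρ ha hy, signedAct_apply L ρ ha hz, signedAct_apply L ρ hb hxz,
        signedAct_apply L ρ e1 hz, signedAct_apply L ρ e2 hz,
        ρ.act_bracket _ _ _ _ _ hx hy, ρ.act_bracket _ _ _ _ _ hy hz,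
        ρ.act_bracket _ _ _ _ _ hx hz]
      have hz2 : ∀ m : ZMod 2, m = 0 ∨ m = 1 := by decide
      have h10 : ¬ ((0 : ZMod 2) = 1) := by decide
      have h11 : (1 : ZMod 2) + 1 = 0 := by decide
      rcases hz2 i with rfl | rfl <;> rcases hz2 j with rfl | rfl <;>
        rcases hz2 k with rfl | rfl <;> simp [sgn, h11] <;> abel

end Semidirect

/-! ### The Lie superalgebra `𝔰̄` -/

/-- The index set of the basis `{L_n, G_n | n ∈ ℤ}` of `𝔰̄`. -/
inductive Idx
  | L (n : ℤ)
  | G (n : ℤ)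

/-- The parity of the basis vectors: `L_n` is even, `G_n` is odd. -/
def Idx.parity : Idx → ZMod 2
  | .L _ => 0
  | .G _ => 1

/-- The space `𝔰̄` with basis `{L_n, G_n | n ∈ ℤ}`. -/
abbrev SBar : Type := Idx →₀ ℂ

/-- The basis vector `L_n`. -/
def Lgen (n : ℤ) : SBar := Finsupp.single (.L n) 1

/-- The basis vector `G_n`. -/
def Ggen (n : ℤ) : SBar := Finsupp.single (.G n) 1

/-- The brackets of the basis vectors of `𝔰̄`. -/
def bracketBasis : Idx → Idx → SBar
  | .L m, .L n => ((n : ℂ) - m) • Lgen (m + n)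
  | .L m, .G p => ((p : ℂ) - m / 2) • Ggen (p + m)
  | .G p, .L m => -(((p : ℂ) - m / 2) • Ggen (p + m))
  | .G p, .G q => (-2 : ℂ) • Lgen (p + q)

/-- The bilinear extension of `bracketBasis`. -/
def sBarBracket : SBar →ₗ[ℂ] SBar →ₗ[ℂ] SBar :=
  Finsupp.linearCombination ℂ fun i => Finsupp.linearCombination ℂ (bracketBasis i)

/-- The grading of `𝔰̄`. -/
def sBarSuperspace : Superspace SBar where
  gr i := Finsupp.supported ℂ ℂ {k | k.parity = i}
  isCompl := by
    constructor
    · refine Finsupp.disjoint_supported_supported ?_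
      rw [Set.disjoint_left]
      intro k h0 h1
      simp only [Set.mem_ofPred_eq] at h0 h1
      rw [h0] at h1
      exact absurd h1 (by decide)
    · refine Finsupp.codisjoint_supported_supported ?_
      rw [codisjoint_iff]
      ext k
      cases k <;> simp [Idx.parity]

lemma sBarBracket_single (i j : Idx) :
    sBarBracket (Finsupp.single i 1) (Finsupp.single j 1) = bracketBasis i j := by
  simp [sBarBracket]

lemma sBar_induction {i : ZMod 2} {p : SBar → Prop} (h0 : p 0)
    (hadd : ∀ x y, p x → p y → p (x + y)) (hsmul : ∀ (c : ℂ) x, p x → p (c • x))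
    (hb : ∀ k : Idx, k.parity = i → p (Finsupp.single k 1)) {x : SBar}
    (hx : x ∈ sBarSuperspace.gr i) : p x := by
  simp only [sBarSuperspace, Finsupp.supported_eq_span_single] at hx
  induction hx using Submodule.span_induction with
  | mem x h => obtain ⟨k, hk, rfl⟩ := h; exact hb k hk
  | zero => exact h0
  | add x y _ _ h1 h2 => exact hadd x y h1 h2
  | smul c x _ h => exact hsmul c x h

lemma single_mem_sBar (k : Idx) : Finsupp.single k 1 ∈ sBarSuperspace.gr k.parity :=
  Finsupp.single_mem_supported ℂ 1 rfl

lemma Lgen_mem (n : ℤ) : Lgen n ∈ sBarSuperspace.gr 0 := single_mem_sBar (.L n)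
lemma Ggen_mem (n : ℤ) : Ggen n ∈ sBarSuperspace.gr 1 := single_mem_sBar (.G n)

lemma sBar_LL (m n : ℤ) : sBarBracket (Lgen m) (Lgen n) = ((n : ℂ) - m) • Lgen (m + n) :=
  sBarBracket_single _ _
lemma sBar_LG (m p : ℤ) : sBarBracket (Lgen m) (Ggen p) = ((p : ℂ) - m / 2) • Ggen (p + m) :=
  sBarBracket_single _ _
lemma sBar_GL (m p : ℤ) :
    sBarBracket (Ggen p) (Lgen m) = -(((p : ℂ) - m / 2) • Ggen (p + m)) :=
  sBarBracket_single _ _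
lemma sBar_GG (p q : ℤ) : sBarBracket (Ggen p) (Ggen q) = (-2 : ℂ) • Lgen (p + q) :=
  sBarBracket_single _ _

/-- The Lie superalgebra `𝔰̄`: the `N = 1` Ramond algebra modulo its central element, with
`[L_m, L_n] = (n - m) L_{m+n}`, `[L_m, G_p] = (p - m/2) G_{p+m}`, `[G_p, G_q] = -2 L_{p+q}`. -/
def sBar : LieSuperalgebra SBar where
  toSuperspace := sBarSuperspace
  bracket := sBarBracket
  bracket_mem := by
    intro i j x y hx hy
    refine sBar_induction (i := i) (p := fun x => sBarBracket x y ∈ _) (by simp)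
      (fun x x' h h' => by simpa using add_mem h h')
      (fun c x h => by simpa using Submodule.smul_mem _ c h) ?_ hx
    intro k hk
    refine sBar_induction (i := j) (p := fun y => sBarBracket _ y ∈ _) (by simp)
      (fun x x' h h' => by simpa using add_mem h h')
      (fun c x h => by simpa using Submodule.smul_mem _ c h) ?_ hy
    intro l hl
    subst hk hl
    rw [sBarBracket_single]
    have h11 : (1 : ZMod 2) + 1 = 0 := by decide
    rcases k with m | m <;> rcases l with n | n <;>
      simp only [bracketBasis, Idx.parity, add_zero, zero_add, h11]
    · exact Submodule.smul_mem _ _ (Lgen_mem _)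
    · exact Submodule.smul_mem _ _ (Ggen_mem _)
    · exact neg_mem (Submodule.smul_mem _ _ (Ggen_mem _))
    · exact Submodule.smul_mem _ _ (Lgen_mem _)
  skew := by
    intro i j x y hx hy
    refine sBar_induction (i := i)
      (p := fun x => sBarBracket x y = -(sgn i j • sBarBracket y x)) (by simp)
      (fun x x' h h' => by
        simp only [map_add, LinearMap.add_apply, smul_add, h, h']; abel)
      (fun c x h => by
        simp only [map_smul, LinearMap.smul_apply, h, smul_neg, smul_comm c]) ?_ hx
    intro k hk
    refine sBar_induction (i := j)
      (p := fun y => sBarBracket _ y = -(sgn i j • sBarBracket y _)) (by simp)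
      (fun x x' h h' => by
        simp only [map_add, LinearMap.add_apply, smul_add, h, h']; abel)
      (fun c x h => by
        simp only [map_smul, LinearMap.smul_apply, h, smul_neg, smul_comm c]) ?_ hy
    intro l hl
    subst hk hl
    rw [sBarBracket_single, sBarBracket_single]
    rcases k with m | m <;> rcases l with n | n <;>
      simp [bracketBasis, Idx.parity, sgn]
    · rw [add_comm m n]; module
    · rw [add_comm m n]
  jacobi := by
    intro i j k x y z hx hy hz
    refine sBar_induction (i := i)
      (p := fun x => sBarBracket x (sBarBracket y z) = sBarBracket (sBarBracket x y) z
        + sgn i j • sBarBracket y (sBarBracket x z)) (by simp)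
      (fun x x' h h' => by
        simp only [map_add, LinearMap.add_apply, smul_add, h, h']; abel)
      (fun c x h => by
        simp only [map_smul, LinearMap.smul_apply, h, smul_add, smul_comm c]) ?_ hx
    intro a ha
    refine sBar_induction (i := j)
      (p := fun y => sBarBracket _ (sBarBracket y z) = sBarBracket (sBarBracket _ y) z
        + sgn i j • sBarBracket y (sBarBracket _ z)) (by simp)
      (fun x x' h h' => by
        simp only [map_add, LinearMap.add_apply, smul_add, h, h']; abel)
      (fun c x h => by
        simp only [map_smul, LinearMap.smul_apply, h, smul_add, smul_comm c]) ?_ hy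
    intro b hb
    refine sBar_induction (i := k)
      (p := fun z => sBarBracket _ (sBarBracket _ z) = sBarBracket (sBarBracket _ _) z
        + sgn i j • sBarBracket _ (sBarBracket _ z)) (by simp)
      (fun x x' h h' => by
        simp only [map_add, smul_add, h, h']; abel)
      (fun c x h => by
        simp only [map_smul, h, smul_add, smul_comm c]) ?_ hz
    intro c hc
    subst ha hb hc
    simp only [sBarBracket_single]
    have hL : ∀ n : ℤ, (Finsupp.single (Idx.L n) 1 : SBar) = Lgen n := fun _ => rfl
    have hG : ∀ n : ℤ, (Finsupp.single (Idx.G n) 1 : SBar) = Ggen n := fun _ => rfl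
    rcases a with a | a <;> rcases b with b | b <;> rcases c with c | c <;>
      simp [bracketBasis, hL, hG, sBar_LL, sBar_LG, sBar_GL, sBar_GG, Idx.parity, sgn] <;>
      abel_nf <;> module

/-! ### The algebra `A = ℂ[t^{±1}] ⊗ Λ(1)` -/

/-- `A = ℂ[t^{±1}] ⊗ Λ(1) = ℂ[t^{±1}] ⊕ ℂ[t^{±1}] ξ` with `ξ² = 0`. It has the basis
`{t^i, t^i ξ | i ∈ ℤ}`. -/
abbrev A : Type := DualNumber ℂ[T;T⁻¹]

/-- The element `t^i` of `A`. -/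
def t (i : ℤ) : A := TrivSqZeroExt.inl (LaurentPolynomial.T i)

/-- The element `ξ` of `A`. -/
def xi : A := DualNumber.eps

/-- The component `p` of `p + q ξ`. -/
def aFst : A →ₗ[ℂ] ℂ[T;T⁻¹] :=
  (TrivSqZeroExt.fstHom ℂ ℂ[T;T⁻¹] ℂ[T;T⁻¹]).toLinearMap

/-- The component `q` of `p + q ξ`. -/
def aSnd : A →ₗ[ℂ] ℂ[T;T⁻¹] :=
  (TrivSqZeroExt.sndHom ℂ[T;T⁻¹] ℂ[T;T⁻¹]).restrictScalars ℂ

/-- The homogeneous subspaces of `A`: the even part is `ℂ[t^{±1}]`, the odd part `ℂ[t^{±1}] ξ`. -/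
def aGr (i : ZMod 2) : Submodule ℂ A := if i = 0 then LinearMap.ker aSnd else LinearMap.ker aFst

/-- The linear map on `A` with `t^i ↦ f i` and `t^i ξ ↦ h i`. -/
def aExt (f h : ℤ → A) : A →ₗ[ℂ] A :=
  Finsupp.linearCombination ℂ f ∘ₗ (AddMonoidAlgebra.coeffLinearEquiv ℂ).toLinearMap ∘ₗ aFst +
  Finsupp.linearCombination ℂ h ∘ₗ (AddMonoidAlgebra.coeffLinearEquiv ℂ).toLinearMap ∘ₗ aSnd

/-- The derivation `∂_t` of `A`: `t^i ↦ i t^{i-1}`, `t^i ξ ↦ i t^{i-1} ξ`. -/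
def dt : A →ₗ[ℂ] A := aExt (fun i => (i : ℂ) • t (i - 1)) (fun i => (i : ℂ) • (t (i - 1) * xi))

/-- The derivation `∂_ξ` of `A`: `t^i ↦ 0`, `t^i ξ ↦ t^i`. -/
def dxi : A →ₗ[ℂ] A := aExt (fun _ => 0) (fun i => t i)

/-- The action `x ↦ (y ↦ x ∘ y)` of `𝔰̄` on `A`:
`L_n ∘ y = t^{n+1} ∂_t(y) + (n/2) t^n ξ ∂_ξ(y)` and `G_n ∘ y = t^{n+1} ξ ∂_t(y) - t^n ∂_ξ(y)`. -/
def circ : SBar →ₗ[ℂ] Module.End ℂ A :=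
  Finsupp.linearCombination ℂ fun k : Idx => match k with
    | .L n => LinearMap.mulLeft ℂ (t (n + 1)) ∘ₗ dt
        + ((n : ℂ) / 2) • (LinearMap.mulLeft ℂ (t n * xi) ∘ₗ dxi)
    | .G n => LinearMap.mulLeft ℂ (t (n + 1) * xi) ∘ₗ dt - LinearMap.mulLeft ℂ (t n) ∘ₗ dxi

/-- The action of `𝔰̄` on `Γ(λ, b) = A ⊗ ℂ u`, where `y ⊗ u` is written as `y`:
* `L_m t^i = (λ + i + m b) t^{m+i}`, `L_m (t^i ξ) = (λ + i + m (b + 1/2)) t^{m+i} ξ`,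
* `G_m t^i = (λ + i + 2 m b) t^{m+i} ξ`, `G_m (t^i ξ) = - t^{m+i}`. -/
def gammaAct (lam b : ℂ) : SBar →ₗ[ℂ] Module.End ℂ A :=
  Finsupp.linearCombination ℂ fun k : Idx => match k with
    | .L m => aExt (fun i => (lam + i + m * b) • t (m + i))
        (fun i => (lam + i + m * (b + 1 / 2)) • (t (m + i) * xi))
    | .G m => aExt (fun i => (lam + i + 2 * m * b) • (t (m + i) * xi)) (fun i => -t (m + i))

lemma t_mul_t (i j : ℤ) : t i * t j = t (i + j) := by
  rw [t, t, t, LaurentPolynomial.T_add, TrivSqZeroExt.inl_mul]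
lemma xi_mul_xi : xi * xi = 0 := DualNumber.eps_mul_eps
lemma txi_mul_t (i j : ℤ) : (t i * xi) * t j = t (i + j) * xi := by
  rw [mul_right_comm, t_mul_t]
lemma t_mul_txi (i j : ℤ) : t i * (t j * xi) = t (i + j) * xi := by
  rw [← mul_assoc, t_mul_t]
lemma txi_mul_txi (i j : ℤ) : (t i * xi) * (t j * xi) = 0 := by
  rw [mul_mul_mul_comm, xi_mul_xi, mul_zero]
lemma t_zero : t 0 = 1 := by simp [t]

lemma t_mul_xi (i : ℤ) : t i * xi = TrivSqZeroExt.inr (LaurentPolynomial.T i) := by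
  ext <;> simp [t, xi]

lemma aExt_t (f h : ℤ → A) (i : ℤ) : aExt f h (t i) = f i := by
  have h1 : aFst (t i) = AddMonoidAlgebra.single i 1 := rfl
  have h2 : aSnd (t i) = 0 := rfl
  simp only [aExt, LinearMap.add_apply, LinearMap.comp_apply, h1, h2, map_zero, add_zero]
  change Finsupp.linearCombination ℂ f (Finsupp.single i 1) = f i
  simp

lemma aExt_txi (f h : ℤ → A) (i : ℤ) : aExt f h (t i * xi) = h i := by
  rw [t_mul_xi]
  have h1 : aFst (TrivSqZeroExt.inr (LaurentPolynomial.T i) : A) = 0 := rfl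
  have h2 : aSnd (TrivSqZeroExt.inr (LaurentPolynomial.T i) : A) = AddMonoidAlgebra.single i 1 :=
    rfl
  simp only [aExt, LinearMap.add_apply, LinearMap.comp_apply, h1, h2, map_zero, zero_add]
  change Finsupp.linearCombination ℂ h (Finsupp.single i 1) = h i
  simp

lemma t_mem (i : ℤ) : t i ∈ aGr 0 := by simp [aGr, aSnd, t]
lemma txi_mem (i : ℤ) : t i * xi ∈ aGr 1 := by rw [t_mul_xi]; simp [aGr, aFst]

lemma mem_aGr_zero {a : A} : a ∈ aGr 0 ↔ a.snd = 0 := by simp [aGr, aSnd]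
lemma mem_aGr_one {a : A} : a ∈ aGr 1 ↔ a.fst = 0 := by simp [aGr, aFst]

lemma aGr_induction {i : ZMod 2} {p : A → Prop} (h0 : p 0)
    (hadd : ∀ x y, p x → p y → p (x + y)) (hsmul : ∀ (c : ℂ) x, p x → p (c • x))
    (ht : i = 0 → ∀ k, p (t k)) (hx : i = 1 → ∀ k, p (t k * xi)) {a : A} (ha : a ∈ aGr i) :
    p a := by
  have hz2 : ∀ m : ZMod 2, m = 0 ∨ m = 1 := by decide
  obtain rfl | rfl := hz2 i
  · have e : a = TrivSqZeroExt.inl a.fst := by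
      ext <;> simp [mem_aGr_zero.1 ha]
    rw [e]
    induction a.fst using AddMonoidAlgebra.induction_linear with
    | zero => simpa using h0
    | add f g hf hg => simpa using hadd _ _ hf hg
    | single n c =>
      have := hsmul c _ (ht rfl n)
      rw [t, ← TrivSqZeroExt.inl_smul, LaurentPolynomial.T, AddMonoidAlgebra.smul_single,
        smul_eq_mul, mul_one] at this
      exact this
  · have e : a = TrivSqZeroExt.inr a.snd := by
      ext <;> simp [mem_aGr_one.1 ha]
    rw [e]
    induction a.snd using AddMonoidAlgebra.induction_linear with
    | zero => rw [TrivSqZeroExt.inr_zero]; exact h0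
    | add f g hf hg => rw [TrivSqZeroExt.inr_add]; exact hadd _ _ hf hg
    | single n c =>
      have := hsmul c _ (hx rfl n)
      rw [t_mul_xi] at this
      rw [← TrivSqZeroExt.inr_smul, LaurentPolynomial.T, AddMonoidAlgebra.smul_single,
        smul_eq_mul, mul_one] at this
      exact this

lemma a_isCompl : IsCompl (aGr 0) (aGr 1) := by
  constructor
  · rw [Submodule.disjoint_def]
    intro a h0 h1
    ext1
    · exact mem_aGr_one.1 h1
    · exact mem_aGr_zero.1 h0
  · rw [codisjoint_iff, Submodule.eq_top_iff']
    intro a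
    rw [← TrivSqZeroExt.inl_fst_add_inr_snd_eq a]
    exact Submodule.add_mem_sup (mem_aGr_zero.2 (by simp)) (mem_aGr_one.2 (by simp))

lemma a_induction {p : A → Prop} (h0 : p 0)
    (hadd : ∀ x y, p x → p y → p (x + y)) (hsmul : ∀ (c : ℂ) x, p x → p (c • x))
    (ht : ∀ k, p (t k)) (hx : ∀ k, p (t k * xi)) (a : A) : p a := by
  obtain ⟨y, hy, z, hz, rfl⟩ := Submodule.mem_sup.1
    ((a_isCompl.sup_eq_top).symm ▸ Submodule.mem_top : a ∈ aGr 0 ⊔ aGr 1)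
  exact hadd _ _ (aGr_induction h0 hadd hsmul (fun _ => ht) (fun _ => hx) hy)
    (aGr_induction h0 hadd hsmul (fun _ => ht) (fun _ => hx) hz)

lemma gamma_L_t (lam b : ℂ) (m i : ℤ) :
    gammaAct lam b (Lgen m) (t i) = (lam + i + m * b) • t (m + i) := by
  simp [gammaAct, Lgen, aExt_t]
lemma gamma_L_txi (lam b : ℂ) (m i : ℤ) :
    gammaAct lam b (Lgen m) (t i * xi) = (lam + i + m * (b + 1 / 2)) • (t (m + i) * xi) := by
  simp [gammaAct, Lgen, aExt_txi]
lemma gamma_G_t (lam b : ℂ) (m i : ℤ) :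
    gammaAct lam b (Ggen m) (t i) = (lam + i + 2 * m * b) • (t (m + i) * xi) := by
  simp [gammaAct, Ggen, aExt_t]
lemma gamma_G_txi (lam b : ℂ) (m i : ℤ) :
    gammaAct lam b (Ggen m) (t i * xi) = -t (m + i) := by
  simp [gammaAct, Ggen, aExt_txi]

lemma circ_eq : circ = gammaAct 0 0 := by
  refine Finsupp.lhom_ext' fun k => LinearMap.ext_ring (LinearMap.ext fun a => ?_)
  rcases k with n | n
  · induction a using a_induction with
    | h0 => simp
    | hadd x y hx hy => simp only [map_add, hx, hy]
    | hsmul c x hx => simp only [map_smul, hx]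
    | ht k => simp [-LinearMap.mulLeft_mul, circ, gammaAct, dt, dxi, aExt_t, t_mul_t]
    | hx k =>
      simp [-LinearMap.mulLeft_mul, circ, gammaAct, dt, dxi, aExt_txi, t_mul_txi, txi_mul_t]
      module
  · induction a using a_induction with
    | h0 => simp
    | hadd x y hx hy => simp only [map_add, hx, hy]
    | hsmul c x hx => simp only [map_smul, hx]
    | ht k => simp [-LinearMap.mulLeft_mul, circ, gammaAct, dt, dxi, aExt_t, txi_mul_t]
    | hx k => simp [-LinearMap.mulLeft_mul, circ, gammaAct, dt, dxi, aExt_txi, txi_mul_txi, t_mul_t]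

lemma gammaAct_mem (lam b : ℂ) {i j : ZMod 2} {x : SBar} {v : A} (hx : x ∈ sBar.gr i)
    (hv : v ∈ aGr j) : gammaAct lam b x v ∈ aGr (i + j) := by
  have hL : ∀ n : ℤ, (Finsupp.single (Idx.L n) 1 : SBar) = Lgen n := fun _ => rfl
  have hG : ∀ n : ℤ, (Finsupp.single (Idx.G n) 1 : SBar) = Ggen n := fun _ => rfl
  have h11 : (1 : ZMod 2) + 1 = 0 := by decide
  refine sBar_induction (i := i) (p := fun x => gammaAct lam b x v ∈ _) (by simp)
      (fun x x' h h' => by simpa using add_mem h h')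
      (fun c x h => by simpa using Submodule.smul_mem _ c h) ?_ hx
  intro k hk
  refine aGr_induction (i := j) (p := fun v => gammaAct lam b _ v ∈ _) (by simp)
      (fun x x' h h' => by simpa using add_mem h h')
      (fun c x h => by simpa using Submodule.smul_mem _ c h) ?_ ?_ hv
  · rintro rfl l
    subst hk
    rcases k with n | n
    · simpa [hL, gamma_L_t, Idx.parity] using Submodule.smul_mem _ _ (t_mem _)
    · simpa [hG, gamma_G_t, Idx.parity] using Submodule.smul_mem _ _ (txi_mem _)
  · rintro rfl l
    subst hk
    rcases k with n | n
    · rw [hL, gamma_L_txi]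
      simpa [Idx.parity] using Submodule.smul_mem _ _ (txi_mem _)
    · simpa [hG, gamma_G_txi, Idx.parity, h11] using t_mem _

lemma gammaAct_bracket (lam b : ℂ) {i j : ZMod 2} {x y : SBar} (v : A) (hx : x ∈ sBar.gr i)
    (hy : y ∈ sBar.gr j) : gammaAct lam b (sBar.bracket x y) v =
      gammaAct lam b x (gammaAct lam b y v) - sgn i j • gammaAct lam b y (gammaAct lam b x v) := by
  have hL : ∀ n : ℤ, (Finsupp.single (Idx.L n) 1 : SBar) = Lgen n := fun _ => rfl
  have hG : ∀ n : ℤ, (Finsupp.single (Idx.G n) 1 : SBar) = Ggen n := fun _ => rfl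
  refine sBar_induction (i := i) (p := fun x => gammaAct lam b (sBarBracket x y) v =
      gammaAct lam b x (gammaAct lam b y v) - sgn i j • gammaAct lam b y (gammaAct lam b x v))
      (by simp)
      (fun x x' h h' => by
        simp only [map_add, LinearMap.add_apply, smul_add, h, h']; abel)
      (fun c x h => by
        simp only [map_smul, LinearMap.smul_apply, h, smul_sub, smul_comm c]) ?_ hx
  intro k hk
  refine sBar_induction (i := j) (p := fun y => gammaAct lam b (sBarBracket _ y) v =
      gammaAct lam b _ (gammaAct lam b y v) - sgn i j • gammaAct lam b y (gammaAct lam b _ v))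
      (by simp)
      (fun x x' h h' => by
        simp only [map_add, LinearMap.add_apply, smul_add, h, h']; abel)
      (fun c x h => by
        simp only [map_smul, LinearMap.smul_apply, h, smul_sub, smul_comm c]) ?_ hy
  intro l hl
  subst hk hl
  induction v using a_induction with
  | h0 => simp
  | hadd x x' h h' => simp only [map_add, smul_add, h, h']; abel
  | hsmul c x h => simp only [map_smul, h, smul_sub, smul_comm c]
  | ht n =>
    rw [sBarBracket_single]
    rcases k with k | k <;> rcases l with l | l <;>
      simp only [bracketBasis, hL, hG, map_smul, map_neg, LinearMap.smul_apply,
        LinearMap.neg_apply, gamma_L_t, gamma_L_txi, gamma_G_t, gamma_G_txi, Idx.parity, sgn] <;>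
      simp <;> abel_nf <;> module
  | hx n =>
    rw [sBarBracket_single]
    rcases k with k | k <;> rcases l with l | l <;>
      simp only [bracketBasis, hL, hG, map_smul, map_neg, LinearMap.smul_apply,
        LinearMap.neg_apply, gamma_L_t, gamma_L_txi, gamma_G_t, gamma_G_txi, Idx.parity, sgn] <;>
      simp <;> abel_nf <;> module

/-- `A` as a module over `𝔰̄`. -/
def aModule : SuperModule sBar A where
  gr := aGr
  isCompl := a_isCompl
  act := circ
  act_mem := fun _ _ _ _ hx hv => circ_eq ▸ gammaAct_mem 0 0 hx hv
  act_bracket := fun _ _ _ _ v hx hy => circ_eq ▸ gammaAct_bracket 0 0 v hx hy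

/-! ### The Lie superalgebra `𝔰̃ = 𝔰̄ ⋉ A` and its modules -/

/-- The Lie superalgebra `𝔰̃ = 𝔰̄ ⋉ A`, in which `A` is abelian and `[x, y] = x ∘ y` for
`x ∈ 𝔰̄`, `y ∈ A`. -/
def sTilde : LieSuperalgebra (SBar × A) := semidirect sBar aModule

/-- An `A𝔰̄`-module: an `𝔰̃`-module on which `A` acts associatively. -/
structure ASModule (M : Type*) [AddCommGroup M] [Module ℂ M] extends SuperModule sTilde M where
  act_one : ∀ v, act (0, 1) v = v
  act_mul : ∀ (a c : A) v, act (0, a * c) v = act (0, a) (act (0, c) v)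

namespace ASModule

variable {M : Type*} [AddCommGroup M] [Module ℂ M] (ρ : ASModule M)

/-- The space `M_μ = {v ∈ M | L_0 v = μ v}`. -/
def weightSpace (μ : ℂ) : Submodule ℂ M := Module.End.eigenspace (ρ.act (Lgen 0, 0)) μ

/-- The support `{μ | M_μ ≠ 0}`. -/
def supp : Set ℂ := {μ | ρ.weightSpace μ ≠ ⊥}

/-- `M` is a weight module: `L_0` acts diagonalizably. -/
def IsWeight : Prop := ⨆ μ : ℂ, ρ.weightSpace μ = ⊤

/-- `M` is cuspidal: it is a weight module, and the dimensions of its weight spaces are (finite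
and) uniformly bounded. -/
def IsCuspidal : Prop :=
  ρ.IsWeight ∧ ∃ N : ℕ, ∀ μ ∈ ρ.supp, Module.rank ℂ (ρ.weightSpace μ) < (N : Cardinal)

end ASModule

/-! ### The modules `Γ(λ, b)` -/

lemma a_supercomm {i j : ZMod 2} {a c : A} (ha : a ∈ aGr i) (hc : c ∈ aGr j) :
    a * c = sgn i j • (c * a) := by
  by_cases h : i = 1 ∧ j = 1
  · obtain ⟨rfl, rfl⟩ := h
    have h1 := mem_aGr_one.1 ha
    have h2 := mem_aGr_one.1 hc
    ext <;> simp [h1, h2]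
  · simp [sgn, h, mul_comm]

lemma a_mul_mem {i j : ZMod 2} {a c : A} (ha : a ∈ aGr i) (hc : c ∈ aGr j) :
    a * c ∈ aGr (i + j) := by
  have hz2 : ∀ m : ZMod 2, m = 0 ∨ m = 1 := by decide
  have h11 : (1 : ZMod 2) + 1 = 0 := by decide
  rcases hz2 i with rfl | rfl <;> rcases hz2 j with rfl | rfl <;>
    simp_all [mem_aGr_zero, mem_aGr_one]

lemma gamma_leibniz (lam b : ℂ) {i j : ZMod 2} {x : SBar} {a : A} (v : A) (hx : x ∈ sBar.gr i)
    (ha : a ∈ aGr j) : gammaAct lam b x (a * v) =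
      circ x a * v + sgn i j • (a * gammaAct lam b x v) := by
  rw [circ_eq]
  have hL : ∀ n : ℤ, (Finsupp.single (Idx.L n) 1 : SBar) = Lgen n := fun _ => rfl
  have hG : ∀ n : ℤ, (Finsupp.single (Idx.G n) 1 : SBar) = Ggen n := fun _ => rfl
  refine sBar_induction (i := i) (p := fun x => gammaAct lam b x (a * v) =
      gammaAct 0 0 x a * v + sgn i j • (a * gammaAct lam b x v))
      (by simp)
      (fun x x' h h' => by
        simp only [map_add, LinearMap.add_apply, smul_add, h, h', add_mul, mul_add]; abel)
      (fun c x h => by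
        simp only [map_smul, LinearMap.smul_apply, h, smul_add, smul_comm c, smul_mul_assoc,
          mul_smul_comm]) ?_ hx
  intro k hk
  refine aGr_induction (i := j) (p := fun a => gammaAct lam b _ (a * v) =
      gammaAct 0 0 _ a * v + sgn i j • (a * gammaAct lam b _ v))
      (by simp)
      (fun x x' h h' => by
        simp only [map_add, smul_add, h, h', add_mul]; abel)
      (fun c x h => by
        simp only [map_smul, h, smul_add, smul_comm c, smul_mul_assoc]) ?_ ?_ ha
  · rintro rfl l
    subst hk
    induction v using a_induction with
    | h0 => simp
    | hadd x x' h h' => simp only [map_add, smul_add, h, h', mul_add]; abel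
    | hsmul c x h => simp only [map_smul, h, smul_add, smul_comm c, mul_smul_comm]
    | ht n =>
      rcases k with k | k <;>
      simp only [hL, hG, gamma_L_t, gamma_L_txi, gamma_G_t, gamma_G_txi, Idx.parity, sgn,
        t_mul_t, t_mul_txi, txi_mul_t, txi_mul_txi, smul_mul_assoc, mul_smul_comm, neg_mul,
        mul_neg] <;>
      simp <;> abel_nf <;> module
    | hx n =>
      rcases k with k | k <;>
      simp only [hL, hG, gamma_L_t, gamma_L_txi, gamma_G_t, gamma_G_txi, Idx.parity, sgn,
        t_mul_t, t_mul_txi, txi_mul_t, txi_mul_txi, smul_mul_assoc, mul_smul_comm, neg_mul,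
        mul_neg] <;>
      simp <;> abel_nf <;> module
  · rintro rfl l
    subst hk
    induction v using a_induction with
    | h0 => simp
    | hadd x x' h h' => simp only [map_add, smul_add, h, h', mul_add]; abel
    | hsmul c x h => simp only [map_smul, h, smul_add, smul_comm c, mul_smul_comm]
    | ht n =>
      rcases k with k | k <;>
      simp only [hL, hG, gamma_L_t, gamma_L_txi, gamma_G_t, gamma_G_txi, Idx.parity, sgn,
        t_mul_t, t_mul_txi, txi_mul_t, txi_mul_txi, smul_mul_assoc, mul_smul_comm, neg_mul,
        mul_neg] <;>
      simp <;> abel_nf <;> module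
    | hx n =>
      rcases k with k | k <;>
      simp only [hL, hG, gamma_L_t, gamma_L_txi, gamma_G_t, gamma_G_txi, Idx.parity, sgn,
        t_mul_t, t_mul_txi, txi_mul_t, txi_mul_txi, smul_mul_assoc, mul_smul_comm, neg_mul,
        mul_neg] <;>
      simp <;> abel_nf <;> module

/-- The `A𝔰̄`-module `Γ(λ, b) = A ⊗ ℂ u`, where `u` is a homogeneous vector of parity `ε` and
`y ⊗ u` is written as `y`. The algebra `A` acts by multiplication, and `𝔰̄` acts by `gammaAct`. -/
def Gamma (lam b : ℂ) (ε : ZMod 2) : ASModule A where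
  gr i := aGr (i - ε)
  isCompl := by
    have hz2 : ∀ m : ZMod 2, m = 0 ∨ m = 1 := by decide
    rcases hz2 ε with rfl | rfl
    · simpa using a_isCompl
    · exact a_isCompl.symm
  act := (gammaAct lam b).coprod (LinearMap.mul ℂ A)
  act_mem := by
    rintro i j ⟨x, a⟩ v ⟨hx, ha⟩ hv
    rw [LinearMap.coprod_apply, LinearMap.add_apply, add_sub_assoc]
    exact add_mem (gammaAct_mem lam b hx hv) (a_mul_mem ha hv)
  act_bracket := by
    rintro i j ⟨x, a⟩ ⟨y, c⟩ v ⟨hx, ha⟩ ⟨hy, hc⟩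
    have hs : sgn j i = sgn i j := by simp [sgn, and_comm]
    have h2 : sgn i j * sgn i j = 1 := by unfold sgn; split_ifs <;> norm_num
    have e1 : aModule.act x c - signedAct sBar aModule a y = circ x c - sgn i j • circ y a := by
      rw [signedAct_apply sBar aModule ha hy]; rfl
    have e2 := gamma_leibniz lam b v hx hc
    have e3 := gamma_leibniz lam b v hy ha
    have e4 : a * (c * v) = sgn i j • (c * (a * v)) := by
      rw [← mul_assoc, a_supercomm ha hc, smul_mul_assoc, mul_assoc]
    change gammaAct lam b (sBar.bracket x y) v +
      (aModule.act x c - signedAct sBar aModule a y) * v =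
      gammaAct lam b x (gammaAct lam b y v + c * v) + a * (gammaAct lam b y v + c * v)
      - sgn i j • (gammaAct lam b y (gammaAct lam b x v + a * v)
        + c * (gammaAct lam b x v + a * v))
    rw [e1, gammaAct_bracket lam b v hx hy]
    simp only [map_add, mul_add, smul_add, e2, e3, e4, hs, sub_mul, smul_mul_assoc, smul_smul, h2,
      one_smul]
    abel
  act_one v := by simp
  act_mul a c v := by simp [mul_assoc]

end Ramond

end

/-! The plan is to find in `M` a homogeneous vector `w` that behaves like `ξ ⊗ u`, and to recover
`u` as `-G_0 w`. The module generated by `u` is then a copy of `Γ(λ, b)`, and simplicity makes it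
all of `M`.

To find `w`, fix a weight `λ` and consider the vectors of weight `λ` killed by `ξ`. This space is
finite-dimensional, and it is nonzero for some `λ` because `ξ` commutes with `L_0` and squares to
zero. It is stable under `e_m = t^{-m} L_m - L_0` and `d_m = t^{-m} G_m - G_0`, which represent the
contact fields vanishing at `t = 1` (`isotropyRelations`). Extended linearly to Laurent polynomials
`f`, these operators depend only on `f - f(1)`, and the order of vanishing at `t = 1` filters them.

In finite dimension the fields of high order act by zero, since `ad` of an Euler field has finitely
many eigenvalues. A trace argument then lowers the order one step at a time (`filtration_descend`),
until a nonzero vector is killed by every `d_n` (`exists_forall_d_eq_zero`). On such vectors the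
relation for `d_m d_n + d_n d_m` forces `e_{m+n} = e_m + e_n`, so an eigenvector of `e_1` is an
eigenvector of all `e_m` (`exists_extremal_eigenvector`). The eigenvalue `β` of `e_1` gives `b = β -
1/2`. -/

open scoped LaurentPolynomial

noncomputable section

namespace Ramond

/-! ### Laurent polynomials -/

section Laurent

open LaurentPolynomial

/-- The linear map on Laurent polynomials with `t^n ↦ f n`. -/
def lExt {V : Type*} [AddCommGroup V] [Module ℂ V] (f : ℤ → V) : ℂ[T;T⁻¹] →ₗ[ℂ] V :=
  Finsupp.linearCombination ℂ f ∘ₗ (AddMonoidAlgebra.coeffLinearEquiv ℂ).toLinearMap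

lemma lExt_T {V : Type*} [AddCommGroup V] [Module ℂ V] (f : ℤ → V) (n : ℤ) :
    lExt f (T n) = f n := by
  change Finsupp.linearCombination ℂ f (Finsupp.single n 1) = f n
  simp

lemma laurent_induction {p : ℂ[T;T⁻¹] → Prop} (h0 : p 0) (hadd : ∀ f g, p f → p g → p (f + g))
    (hsmul : ∀ (c : ℂ) f, p f → p (c • f)) (hT : ∀ n, p (T n)) (f : ℂ[T;T⁻¹]) : p f := by
  induction f using AddMonoidAlgebra.induction_linear with
  | zero => exact h0
  | add f g hf hg => exact hadd _ _ hf hg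
  | single n c =>
    have := hsmul c _ (hT n)
    rwa [LaurentPolynomial.T, AddMonoidAlgebra.smul_single, smul_eq_mul, mul_one] at this

/-- The derivation `t d/dt` of the Laurent polynomials. -/
def eulerD : Derivation ℂ ℂ[T;T⁻¹] ℂ[T;T⁻¹] :=
  Derivation.mk' (lExt fun n : ℤ => (n : ℂ) • (T n : ℂ[T;T⁻¹])) (by
    intro a b
    induction a using laurent_induction with
    | h0 => simp
    | hadd f g hf hg => rw [add_mul, map_add, hf, hg, map_add]; simp only [smul_eq_mul]; ring
    | hsmul c f hf =>
      rw [smul_mul_assoc, map_smul, hf, map_smul]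
      simp only [smul_eq_mul, smul_add, smul_mul_assoc, mul_smul_comm]
    | hT m =>
      induction b using laurent_induction with
      | h0 => simp
      | hadd f g hf hg => rw [mul_add, map_add, hf, hg, map_add]; simp only [smul_eq_mul]; ring
      | hsmul c f hf =>
        rw [mul_smul_comm, map_smul, hf, map_smul]
        simp only [smul_eq_mul, smul_add, smul_mul_assoc, mul_smul_comm]
      | hT n =>
        rw [← T_add]
        simp only [lExt_T, smul_eq_mul, mul_smul_comm, ← T_add]
        rw [add_comm n m]
        push_cast
        module)

lemma eulerD_T (n : ℤ) : eulerD (T n) = (n : ℂ) • (T n : ℂ[T;T⁻¹]) := lExt_T _ _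

/-- Evaluation at `t = 1`. -/
def evalOne : ℂ[T;T⁻¹] →ₗ[ℂ] ℂ := lExt fun _ => 1

lemma evalOne_T (n : ℤ) : evalOne (T n) = 1 := lExt_T _ _

/-- The local coordinate `t - 1`. -/
def zc : ℂ[T;T⁻¹] := T 1 - 1

lemma evalOne_zc_mul (a : ℂ[T;T⁻¹]) : evalOne (zc * a) = 0 := by
  induction a using laurent_induction with
  | h0 => simp
  | hadd f g hf hg => rw [mul_add, map_add, hf, hg, add_zero]
  | hsmul c f hf => rw [mul_smul_comm, map_smul, hf, smul_zero]
  | hT n => rw [zc, sub_mul, one_mul, ← T_add, map_sub, evalOne_T, evalOne_T, sub_self]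

lemma T_neg_one_mul : (T (-1) : ℂ[T;T⁻¹]) * T 1 = 1 := by
  rw [← T_add]; simp

lemma eulerD_zc : eulerD zc = T 1 := by
  rw [zc, map_sub, eulerD_T]; simp

lemma eulerD_zc_pow (k : ℕ) : eulerD (zc ^ (k + 1)) = ((k : ℂ) + 1) • (zc ^ k * T 1) := by
  rw [Derivation.leibniz_pow, eulerD_zc]
  simp only [Nat.add_sub_cancel, smul_eq_mul, ← Nat.cast_smul_eq_nsmul ℂ]
  push_cast
  rfl

/-- This is the first-order Taylor expansion at `t = 1`, with remainder in the ideal of `zc`. -/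
lemma exists_T_eq (n : ℤ) : ∃ b : ℂ[T;T⁻¹], T n = 1 + zc * b := by
  induction n using Int.induction_on with
  | zero => exact ⟨0, by simp⟩
  | succ n ih =>
    obtain ⟨b, hb⟩ := ih
    refine ⟨1 + b + zc * b, ?_⟩
    rw [T_add, hb, zc]; ring
  | pred n ih =>
    obtain ⟨b, hb⟩ := ih
    refine ⟨(b - 1) * T (-1), ?_⟩
    rw [sub_eq_add_neg, T_add, hb, zc]
    linear_combination (1 : ℂ[T;T⁻¹]) * T_neg_one_mul

/-- Used to split `zc ^ k * a` into a multiple of `zc ^ k` and a term of order `k + 1`. An operator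
family that vanishes in order `k + 1` is thus controlled in order `k` by one operator. -/
lemma exists_eq_const_add (a : ℂ[T;T⁻¹]) : ∃ (c : ℂ) (b : ℂ[T;T⁻¹]), a = c • 1 + zc * b := by
  induction a using laurent_induction with
  | h0 => exact ⟨0, 0, by simp⟩
  | hadd f g hf hg =>
    obtain ⟨c, b, rfl⟩ := hf
    obtain ⟨c', b', rfl⟩ := hg
    exact ⟨c + c', b + b', by rw [add_smul, mul_add]; abel⟩
  | hsmul c f hf =>
    obtain ⟨c', b, rfl⟩ := hf
    exact ⟨c * c', c • b, by rw [smul_add, smul_smul, mul_smul_comm]⟩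
  | hT n =>
    obtain ⟨b, hb⟩ := exists_T_eq n
    exact ⟨1, b, by rw [one_smul, hb]⟩

end Laurent

/-! ### Operators with eigenvectors for the commutator -/

section Operators

variable {W : Type*} [AddCommGroup W] [Module ℂ W] [FiniteDimensional ℂ W]

/-- If `y` were injective on `U`, it would be invertible there and `h - y h y⁻¹ = c`. The trace of
the left side is zero, while that of the right side is `c * dim U ≠ 0`. -/
lemma exists_ne_zero_apply_eq_zero (U : Submodule ℂ W) (hU : U ≠ ⊥) (h y : Module.End ℂ W)
    (hh : ∀ u ∈ U, h u ∈ U) (hy : ∀ u ∈ U, y u ∈ U) {c : ℂ} (hc : c ≠ 0)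
    (hc' : ∀ u ∈ U, h (y u) - y (h u) = c • y u) : ∃ u ∈ U, u ≠ 0 ∧ y u = 0 := by
  by_contra! hcon
  have hinj : LinearMap.ker (y.restrict hy) = ⊥ := by
    rw [LinearMap.ker_eq_bot']
    rintro ⟨u, hu⟩ h0
    by_contra hne
    exact hcon u hu (by simpa using hne) (by simpa [Subtype.ext_iff] using h0)
  have hunit : IsUnit (y.restrict hy) := LinearMap.isUnit_iff_ker_eq_bot _ |>.2 hinj
  obtain ⟨v, hv⟩ := hunit
  have hrel : h.restrict hh * (v : Module.End ℂ U) - v * h.restrict hh = c • v := by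
    rw [hv]
    ext u
    simpa using hc' u u.2
  have h2 : h.restrict hh - (v : Module.End ℂ U) * h.restrict hh * (↑v⁻¹ : Module.End ℂ U)
      = c • 1 := by
    have := congrArg (· * (↑v⁻¹ : Module.End ℂ U)) hrel
    simpa [sub_mul, mul_assoc] using this
  have h3 := congrArg (LinearMap.trace ℂ U) h2
  rw [map_sub, LinearMap.trace_mul_comm, ← mul_assoc, Units.inv_mul, one_mul, sub_self, map_smul,
    LinearMap.trace_one, smul_eq_mul] at h3
  have : Module.finrank ℂ U ≠ 0 := by
    rw [Ne, Submodule.finrank_eq_zero]; exact hU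
  simp [hc, this] at h3

/-- The nonzero `y k` are eigenvectors of `ad h` for the distinct eigenvalues `k + c`, and `ad h`
acts on the finite-dimensional space `End W`. -/
lemma exists_forall_ge_eq_zero (h : Module.End ℂ W) (y : ℕ → Module.End ℂ W) (c : ℂ)
    (hy : ∀ k, h * y k - y k * h = ((k : ℂ) + c) • y k) : ∃ N, ∀ k ≥ N, y k = 0 := by
  set ad : Module.End ℂ (Module.End ℂ W) := LinearMap.mulLeft ℂ h - LinearMap.mulRight ℂ h
  have hfin : {k : ℕ | y k ≠ 0}.Finite := by
    refine Set.Finite.of_finite_image (f := fun k : ℕ => (k : ℂ) + c)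
      (ad.finite_hasEigenvalue.subset ?_) (fun a _ b _ hab => by simpa using hab)
    rintro _ ⟨k, hk, rfl⟩
    refine Module.End.hasEigenvalue_of_hasEigenvector (x := y k) ⟨?_, hk⟩
    rw [Module.End.mem_eigenspace_iff]
    simpa [ad] using hy k
  obtain ⟨N, hN⟩ := hfin.bddAbove
  refine ⟨N + 1, fun k hk => ?_⟩
  by_contra hne
  have := hN hne
  omega

end Operators

/-! ### Finite-dimensional representations of the isotropy superalgebra -/

/-- The relations between `e_n = t^{-n} L_n - L_0` and `d_n = t^{-n} G_n - G_0`: those of the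
contact vector fields on the supercircle that vanish at a point. -/
structure IsotropyRelations {W : Type*} [AddCommGroup W] [Module ℂ W]
    (e d : ℤ → Module.End ℂ W) : Prop where
  e_zero : e 0 = 0
  d_zero : d 0 = 0
  ee : ∀ m n, e m * e n - e n * e m = ((n : ℂ) - m) • e (m + n) - (n : ℂ) • e n + (m : ℂ) • e m
  ed : ∀ m n, e m * d n - d n * e m =
    ((n : ℂ) - m / 2) • d (m + n) - (n : ℂ) • d n + ((m : ℂ) / 2) • d m
  dd : ∀ m n, d m * d n + d n * d m = (-2 : ℂ) • (e (m + n) - e m - e n)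

namespace IsotropyRelations

open LaurentPolynomial

variable {W : Type*} [AddCommGroup W] [Module ℂ W] {e d : ℤ → Module.End ℂ W}

/-- Writing `D` for `eulerD`, the operator of `f` stands for the field `(f - f(1)) D`. The `evalOne`
terms come from expanding the bracket of two such fields. Both sides are bilinear, so monomials
suffice; the same holds for `lExt_ed` and `lExt_dd`. -/
lemma lExt_ee (hr : IsotropyRelations e d) (f g : ℂ[T;T⁻¹]) :
    lExt e f * lExt e g - lExt e g * lExt e f =
    lExt e (f * eulerD g - g * eulerD f) - evalOne f • lExt e (eulerD g)
      + evalOne g • lExt e (eulerD f) := by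
  induction f using laurent_induction with
  | h0 => simp
  | hadd f f' hf hf' =>
    linear_combination (norm := skip) hf + hf'
    simp only [map_add, map_sub, add_mul, mul_add, add_smul, smul_add]
    module
  | hsmul c f hf =>
    linear_combination (norm := skip) c • hf
    simp only [map_smul, Derivation.map_smul, map_sub, smul_mul_assoc, mul_smul_comm, smul_assoc]
    module
  | hT m =>
    induction g using laurent_induction with
    | h0 => simp
    | hadd f f' hf hf' =>
      linear_combination (norm := skip) hf + hf'
      simp only [map_add, map_sub, add_mul, mul_add, add_smul, smul_add]
      module
    | hsmul c f hf =>
      linear_combination (norm := skip) c • hf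
      simp only [map_smul, Derivation.map_smul, map_sub, smul_mul_assoc, mul_smul_comm, smul_assoc]
      module
    | hT n =>
      simp only [lExt_T, eulerD_T, evalOne_T, map_sub, map_smul, mul_smul_comm, ← T_add, hr.ee,
        add_comm n m, one_smul]
      module

lemma lExt_ed (hr : IsotropyRelations e d) (f g : ℂ[T;T⁻¹]) :
    lExt e f * lExt d g - lExt d g * lExt e f =
    lExt d (f * eulerD g - (1 / 2 : ℂ) • (g * eulerD f)) - evalOne f • lExt d (eulerD g)
      + ((1 / 2 : ℂ) * evalOne g) • lExt d (eulerD f) := by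
  induction f using laurent_induction with
  | h0 => simp
  | hadd f f' hf hf' =>
    linear_combination (norm := skip) hf + hf'
    simp only [map_add, map_sub, map_smul, add_mul, mul_add, add_smul, smul_add]
    module
  | hsmul c f hf =>
    linear_combination (norm := skip) c • hf
    simp only [map_smul, Derivation.map_smul, map_sub, smul_mul_assoc, mul_smul_comm, smul_assoc]
    module
  | hT m =>
    induction g using laurent_induction with
    | h0 => simp
    | hadd f f' hf hf' =>
      linear_combination (norm := skip) hf + hf'
      simp only [map_add, map_sub, map_smul, add_mul, mul_add, add_smul, smul_add]
      module
    | hsmul c f hf =>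
      linear_combination (norm := skip) c • hf
      simp only [map_smul, Derivation.map_smul, map_sub, smul_mul_assoc, mul_smul_comm, smul_assoc,
        smul_eq_mul]
      module
    | hT n =>
      simp only [lExt_T, eulerD_T, evalOne_T, map_sub, map_smul, mul_smul_comm, ← T_add, hr.ed,
        add_comm n m, one_smul]
      module

lemma lExt_dd (hr : IsotropyRelations e d) (f g : ℂ[T;T⁻¹]) :
    lExt d f * lExt d g + lExt d g * lExt d f =
    (-2 : ℂ) • (lExt e (f * g) - evalOne g • lExt e f - evalOne f • lExt e g) := by
  induction f using laurent_induction with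
  | h0 => simp
  | hadd f f' hf hf' =>
    linear_combination (norm := skip) hf + hf'
    simp only [map_add, map_sub, add_mul, mul_add, add_smul, smul_add]
    module
  | hsmul c f hf =>
    linear_combination (norm := skip) c • hf
    simp only [map_smul, Derivation.map_smul, map_sub, smul_mul_assoc, mul_smul_comm, smul_assoc]
    module
  | hT m =>
    induction g using laurent_induction with
    | h0 => simp
    | hadd f f' hf hf' =>
      linear_combination (norm := skip) hf + hf'
      simp only [map_add, map_sub, add_mul, mul_add, add_smul, smul_add]
      module
    | hsmul c f hf =>
      linear_combination (norm := skip) c • hf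
      simp only [map_smul, Derivation.map_smul, map_sub, smul_mul_assoc, mul_smul_comm, smul_assoc]
      module
    | hT n =>
      simp only [lExt_T, evalOne_T, ← T_add, hr.dd, one_smul]

/-- For `f` and `g` vanishing at `t = 1` the corrections disappear, leaving the plain contact
bracket. The result `F` is a parameter so that callers can supply it in a convenient form. -/
lemma ee_of_eq (hr : IsotropyRelations e d) {f g F : ℂ[T;T⁻¹]} (a b : ℂ[T;T⁻¹])
    (hf : f = zc * a) (hg : g = zc * b)
    (hF : f * eulerD g - g * eulerD f = F) :
    lExt e f * lExt e g - lExt e g * lExt e f = lExt e F := by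
  have h1 : evalOne f = 0 := hf ▸ evalOne_zc_mul a
  have h2 : evalOne g = 0 := hg ▸ evalOne_zc_mul b
  simp [hr.lExt_ee, hF, h1, h2]

lemma ed_of_eq (hr : IsotropyRelations e d) {f g F : ℂ[T;T⁻¹]} (a b : ℂ[T;T⁻¹])
    (hf : f = zc * a) (hg : g = zc * b)
    (hF : f * eulerD g - (1 / 2 : ℂ) • (g * eulerD f) = F) :
    lExt e f * lExt d g - lExt d g * lExt e f = lExt d F := by
  have h1 : evalOne f = 0 := hf ▸ evalOne_zc_mul a
  have h2 : evalOne g = 0 := hg ▸ evalOne_zc_mul b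
  rw [hr.lExt_ed, hF, h1, h2]
  simp

lemma dd_of_eq (hr : IsotropyRelations e d) {f g : ℂ[T;T⁻¹]} (a b : ℂ[T;T⁻¹])
    (hf : f = zc * a) (hg : g = zc * b) :
    lExt d f * lExt d g + lExt d g * lExt d f = (-2 : ℂ) • lExt e (f * g) := by
  have h1 : evalOne f = 0 := hf ▸ evalOne_zc_mul a
  have h2 : evalOne g = 0 := hg ▸ evalOne_zc_mul b
  simp [hr.lExt_dd, h1, h2]

end IsotropyRelations

/-! ### Vanishing of the fields of high order -/

namespace IsotropyRelations

open LaurentPolynomial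

variable {W : Type*} [AddCommGroup W] [Module ℂ W] {e d : ℤ → Module.End ℂ W}

lemma exists_lExt_e_eq_zero [FiniteDimensional ℂ W] (hr : IsotropyRelations e d) :
    ∃ N, ∀ k ≥ N, ∀ b, lExt e (zc ^ k * b) = 0 := by
  have hD : eulerD (T (-1)) = -(T (-1) : ℂ[T;T⁻¹]) := by simp [eulerD_T]
  have hT := T_neg_one_mul
  have hz : (T 1 : ℂ[T;T⁻¹]) = zc + 1 := by simp [zc]
  rw [hz] at hT
  -- The factor `t⁻¹` turns `t d/dt` into `d/dt`. With `z = t - 1`, the bracket of `z d/dt` and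
  -- `z^{k+1} d/dt` is exactly `k z^{k+1} d/dt`, with no terms of higher order.
  obtain ⟨N, hN⟩ := exists_forall_ge_eq_zero (lExt e (zc * T (-1)))
    (fun k => lExt e (zc ^ (k + 1) * T (-1))) 0 (fun k => by
      rw [hr.ee_of_eq (T (-1)) (zc ^ k * T (-1)) rfl (by ring) rfl, ← map_smul]
      congr 1
      simp only [Derivation.leibniz, eulerD_zc, eulerD_zc_pow, hD, smul_eq_mul,
        mul_smul_comm, add_zero, hz, Algebra.smul_def, map_add, map_natCast, map_one]
      linear_combination (k : ℂ[T;T⁻¹]) * zc ^ (k + 1) * T (-1) * hT)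
  refine ⟨N + 2, fun k hk b => ?_⟩
  obtain ⟨m, rfl⟩ : ∃ m, k = m + 2 := ⟨k - 2, by omega⟩
  -- Both brackets below have a zero factor on the left. In their difference the derivatives of `b`
  -- and the dependence on `m` cancel, and `-2 zc^{m+2} b` remains.
  have h1 := hr.ee_of_eq (f := zc ^ (m + 1 + 1) * T (-1)) (g := zc * b)
    (zc ^ (m + 1) * T (-1)) b (by ring) rfl rfl
  have h2 := hr.ee_of_eq (f := zc ^ (m + 1) * T (-1)) (g := zc * (zc * b))
    (zc ^ m * T (-1)) (zc * b) (by ring) rfl rfl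
  rw [hN (m + 1) (by omega)] at h1
  rw [hN m (by omega)] at h2
  simp only [zero_mul, mul_zero, sub_self] at h1 h2
  have h3 := congrArg₂ (· - ·) h1 h2
  simp only [← map_sub, sub_self] at h3
  have h4 : (-2 : ℂ) • lExt e (zc ^ (m + 2) * b) = 0 := by
    rw [← map_smul, h3]
    congr 1
    simp only [Derivation.leibniz, eulerD_zc, eulerD_zc_pow, hD, smul_eq_mul,
      mul_smul_comm, add_zero, hz, Algebra.smul_def, map_add, map_natCast, map_one, map_neg,
      map_ofNat, Nat.cast_add, Nat.cast_one]
    linear_combination (2 : ℂ[T;T⁻¹]) * zc ^ (m + 2) * b * hT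
  exact (smul_eq_zero.1 h4).resolve_left (by norm_num)

lemma exists_lExt_d_eq_zero [FiniteDimensional ℂ W] (hr : IsotropyRelations e d) :
    ∃ N, ∀ k ≥ N, ∀ b, lExt d (zc ^ k * b) = 0 := by
  obtain ⟨N, hN⟩ := hr.exists_lExt_e_eq_zero
  have hT := T_neg_one_mul
  have hD : eulerD (T 1) = (T 1 : ℂ[T;T⁻¹]) := by simp [eulerD_T]
  refine ⟨N + 2, fun k hk b => ?_⟩
  obtain ⟨m, rfl⟩ : ∃ m, k = m + 2 := ⟨k - 2, by omega⟩
  -- The unit `t` is moved from the even field to the odd one. The asymmetric bracket `f D(g) -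
  -- (1/2) g D(f)` then changes by `-3/2` times the product, and `T (-1)` in `g` makes this product
  -- `zc^{m+2} b`.
  have h1 := hr.ed_of_eq (f := zc ^ (m + 1) * T 1) (g := zc * (b * T (-1)))
    (zc ^ m * T 1) (b * T (-1)) (by ring) rfl rfl
  have h2 := hr.ed_of_eq (f := zc ^ (m + 1)) (g := zc * (b * T (-1)) * T 1)
    (zc ^ m) (b * T (-1) * T 1) (by ring) (by ring) rfl
  rw [hN (m + 1) (by omega)] at h1
  have h0 := hN (m + 1) (by omega) 1
  rw [mul_one] at h0
  rw [h0] at h2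
  simp only [zero_mul, mul_zero, sub_self] at h1 h2
  have h3 := congrArg₂ (· - ·) h1 h2
  simp only [← map_sub, sub_self] at h3
  have h4 : (-3 / 2 : ℂ) • lExt d (zc ^ (m + 2) * b) = 0 := by
    rw [← map_smul, h3]
    congr 1
    rw [Derivation.leibniz _ (zc * (b * T (-1))) (T 1), Derivation.leibniz _ (zc ^ (m + 1)) (T 1),
      hD]
    simp only [smul_eq_mul]
    have e1 : zc ^ (m + 2) * b = zc ^ (m + 2) * b * (T (-1) * T 1) := by rw [hT, mul_one]
    rw [e1]
    have e2 : (2 : ℂ[T;T⁻¹]) * (algebraMap ℂ _ (1 / 2)) = 1 := by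
      rw [← map_ofNat (algebraMap ℂ ℂ[T;T⁻¹]), ← map_mul]; norm_num
    have e3 : algebraMap ℂ ℂ[T;T⁻¹] (-3 / 2) = -3 * algebraMap ℂ _ (1 / 2) := by
      rw [← map_ofNat (algebraMap ℂ ℂ[T;T⁻¹]) 3, ← map_neg, ← map_mul]; norm_num
    simp only [Algebra.smul_def, e3]
    linear_combination (-1 : ℂ[T;T⁻¹]) * zc ^ (m + 2) * b * T (-1) * T 1 * e2
  exact (smul_eq_zero.1 h4).resolve_left (by norm_num)

/-- The vectors annihilated by the `d`-fields of order `≥ j` and the `e`-fields of order `> j`. -/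
def filtration (e d : ℤ → Module.End ℂ W) (j : ℕ) : Submodule ℂ W :=
  (⨅ b, LinearMap.ker (lExt d (zc ^ j * b))) ⊓ ⨅ b, LinearMap.ker (lExt e (zc ^ (j + 1) * b))

lemma mem_filtration {j : ℕ} {w : W} : w ∈ filtration e d j ↔
    (∀ b, lExt d (zc ^ j * b) w = 0) ∧ ∀ b, lExt e (zc ^ (j + 1) * b) w = 0 := by
  simp [filtration]

/-- The result of applying `x y - y x = F` to a vector annihilated by `x` and `F`. -/
lemma apply_apply_eq_zero {x y F : Module.End ℂ W} (h : x * y - y * x = F) {w : W}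
    (hx : y w = 0) (hF : F w = 0) : y (x w) = 0 := by
  have := LinearMap.congr_fun h w
  simpa [hx, hF] using this

lemma apply_apply_eq_zero_of_add {x y F : Module.End ℂ W} (h : x * y + y * x = F) {w : W}
    (hx : y w = 0) (hF : F w = 0) : y (x w) = 0 := by
  have := LinearMap.congr_fun h w
  simpa [hx, hF] using this

/-! ### Descent along the order of vanishing -/

lemma exists_e_zc_e (hr : IsotropyRelations e d) (k : ℕ) (b : ℂ[T;T⁻¹]) :
  ∃ c, lExt e zc * lExt e (zc ^ (k + 1) * b) -
    lExt e (zc ^ (k + 1) * b) * lExt e zc = lExt e (zc ^ (k + 1) * c) := by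
  refine ⟨(k : ℂ) • (b * T 1) + zc * eulerD b,
    hr.ee_of_eq 1 (zc ^ k * b) (by ring) (by ring) ?_⟩
  simp only [Derivation.leibniz, eulerD_zc, eulerD_zc_pow, smul_eq_mul, Algebra.smul_def,
    map_add, map_natCast, map_one]
  ring

lemma exists_e_zc_d (hr : IsotropyRelations e d) (k : ℕ) (b : ℂ[T;T⁻¹]) :
  ∃ c, lExt e zc * lExt d (zc ^ (k + 1) * b) -
    lExt d (zc ^ (k + 1) * b) * lExt e zc = lExt d (zc ^ (k + 1) * c) := by
  refine ⟨((k : ℂ) + 1 / 2) • (b * T 1) + zc * eulerD b,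
    hr.ed_of_eq 1 (zc ^ k * b) (by ring) (by ring) ?_⟩
  have e3 : algebraMap ℂ ℂ[T;T⁻¹] (1 / 2) + algebraMap ℂ ℂ[T;T⁻¹] (1 / 2) = 1 := by
    rw [← map_add]; norm_num
  simp only [Derivation.leibniz, eulerD_zc, eulerD_zc_pow, smul_eq_mul, Algebra.smul_def,
    map_add, map_natCast, map_one]
  linear_combination (-1 : ℂ[T;T⁻¹]) * zc ^ (k + 1) * b * T 1 * e3

lemma e_zc_mem_filtration (hr : IsotropyRelations e d) (j : ℕ) {u : W}
    (hu : u ∈ filtration e d (j + 1)) :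
    lExt e zc u ∈ filtration e d (j + 1) := by
  rw [mem_filtration] at hu ⊢
  refine ⟨fun b => ?_, fun b => ?_⟩
  · obtain ⟨c, hc⟩ := hr.exists_e_zc_d j b
    exact apply_apply_eq_zero hc (hu.1 b) (hu.1 c)
  · obtain ⟨c, hc⟩ := hr.exists_e_zc_e (j + 1) b
    exact apply_apply_eq_zero hc (hu.2 b) (hu.2 c)

/-- The commutators with the fields defining the filtration have order at least `2j + 3` in the odd
case and `2j + 4` in the even case. They are therefore among the fields that already kill `u`. -/
lemma e_zc_pow_mem_filtration (hr : IsotropyRelations e d) (j : ℕ) {u : W}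
    (hu : u ∈ filtration e d (j + 2)) :
    lExt e (zc ^ (j + 2)) u ∈ filtration e d (j + 2) := by
  rw [mem_filtration] at hu ⊢
  refine ⟨fun b => ?_, fun b => ?_⟩
  · refine apply_apply_eq_zero (hr.ed_of_eq (zc ^ (j + 1)) (zc ^ (j + 1) * b) (by ring) (by ring)
      rfl) (hu.1 b) ?_
    convert hu.1 (zc ^ (j + 1) * (((j : ℂ) + 2) • (b * T 1) + zc * eulerD b -
      (1 / 2 : ℂ) • (b * (((j : ℂ) + 2) • T 1)))) using 3
    simp only [Derivation.leibniz, eulerD_zc_pow, smul_eq_mul, Algebra.smul_def,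
      map_add, map_natCast, map_one, Nat.cast_add, Nat.cast_one, map_ofNat]
    ring
  · refine apply_apply_eq_zero (hr.ee_of_eq (zc ^ (j + 1)) (zc ^ (j + 2) * b) (by ring) (by ring)
      rfl) (hu.2 b) ?_
    convert hu.2 (zc ^ (j + 1) * (((j : ℂ) + 3) • (b * T 1) + zc * eulerD b -
      (b * (((j : ℂ) + 2) • T 1)))) using 3
    simp only [Derivation.leibniz, eulerD_zc_pow, smul_eq_mul, Algebra.smul_def,
      map_add, map_natCast, map_one, Nat.cast_add, Nat.cast_one, map_ofNat]
    ring

/-- On this filtration step fields of higher order act by zero, so `ad` of `lExt e zc` multiplies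
the operator of `zc ^ (j + 2)` by `j + 1`, and the trace argument applies. For the first power of
`zc` the factor would be zero, so this method cannot kill `lExt e zc`. -/
lemma exists_e_zc_pow_eq_zero [FiniteDimensional ℂ W] (hr : IsotropyRelations e d) (j : ℕ)
    (h : filtration e d (j + 2) ≠ ⊥) :
    ∃ u ∈ filtration e d (j + 2), u ≠ 0 ∧ lExt e (zc ^ (j + 2)) u = 0 := by
  have hz : (T 1 : ℂ[T;T⁻¹]) = zc + 1 := by simp [zc]
  exact exists_ne_zero_apply_eq_zero _ h (lExt e zc)
    (lExt e (zc ^ (j + 2))) (fun u => hr.e_zc_mem_filtration (j + 1))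
    (fun u => hr.e_zc_pow_mem_filtration j) (c := (j : ℂ) + 1) (by exact_mod_cast j.succ_ne_zero)
    (fun u hu => by
      rw [mem_filtration] at hu
      have := LinearMap.congr_fun (hr.ee_of_eq (f := zc) (g := zc ^ (j + 2)) 1 (zc ^ (j + 1))
        (by ring) (by ring) (F := ((j : ℂ) + 1) • zc ^ (j + 2) +
          zc ^ (j + 2 + 1) * ((j : ℂ) + 1) • 1) (by
          simp only [eulerD_zc, eulerD_zc_pow, smul_eq_mul, Algebra.smul_def, hz,
            map_add, map_natCast, map_one, Nat.cast_add, Nat.cast_one, map_ofNat]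
          ring)) u
      rw [map_add, LinearMap.add_apply, hu.2, map_smul] at this
      simpa using this)

/-- Two operators separate the consecutive steps: the even one of order `j + 2` and the odd one of
order `j + 1`. Each is killed by a trace argument, the second inside the kernel `U'` of the first.
-/
lemma filtration_descend [FiniteDimensional ℂ W] (hr : IsotropyRelations e d) (j : ℕ)
    (h : filtration e d (j + 2) ≠ ⊥) : filtration e d (j + 1) ≠ ⊥ := by
  have hz : (T 1 : ℂ[T;T⁻¹]) = zc + 1 := by simp [zc]
  obtain ⟨u, huU, hu0, huy⟩ := hr.exists_e_zc_pow_eq_zero j h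
  set U := filtration e d (j + 2) with hU
  set U' : Submodule ℂ W := U ⊓ LinearMap.ker (lExt e (zc ^ (j + 2))) with hU'
  have hne : U' ≠ ⊥ := (Submodule.ne_bot_iff _).2 ⟨u, ⟨huU, huy⟩, hu0⟩
  have hker : ∀ u ∈ U', ∀ b, lExt e (zc ^ (j + 2) * b) u = 0 := fun u hu b => by
    obtain ⟨c, b, rfl⟩ := exists_eq_const_add b
    have h2 := (mem_filtration.1 hu.1).2 b
    have h1 : lExt e (zc ^ (j + 2)) u = 0 := hu.2
    rw [mul_add, map_add, mul_smul_comm, mul_one, map_smul, LinearMap.add_apply,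
      LinearMap.smul_apply, h1, smul_zero, zero_add, ← mul_assoc, ← pow_succ]
    exact h2
  have hU'e : ∀ u ∈ U', lExt e zc u ∈ U' := fun u hu => by
    refine ⟨hr.e_zc_mem_filtration (j + 1) hu.1, ?_⟩
    obtain ⟨c, hc⟩ := hr.exists_e_zc_e (j + 1) 1
    rw [mul_one] at hc
    exact apply_apply_eq_zero hc hu.2 (hker u hu c)
  have hU'x : ∀ u ∈ U', lExt d (zc ^ (j + 1)) u ∈ U' := fun u hu => by
    have huf := mem_filtration.1 hu.1
    -- The commutator is an odd field of order at least `2j + 2 ≥ j + 2`, which kills `u`.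
    have key : ∀ b, lExt e (zc ^ (j + 2) * b) (lExt d (zc ^ (j + 1)) u) = 0 := fun b => by
      have h1 := LinearMap.congr_fun (hr.ed_of_eq (f := zc ^ (j + 2) * b) (g := zc ^ (j + 1))
        (zc ^ (j + 1) * b) (zc ^ j) (by ring) (by ring) rfl) u
      rw [LinearMap.sub_apply, Module.End.mul_apply, Module.End.mul_apply, hker u hu b, map_zero,
        sub_zero] at h1
      rw [h1]
      convert huf.1 (zc ^ j * (((j : ℂ) + 1) • (b * T 1)) -
        (1 / 2 : ℂ) • (zc ^ j * (((j : ℂ) + 2) • (b * T 1) + zc * eulerD b))) using 3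
      simp only [Derivation.leibniz, eulerD_zc_pow, smul_eq_mul, Algebra.smul_def,
        map_add, map_natCast, map_one, Nat.cast_add, Nat.cast_one, map_ofNat]
      ring
    refine ⟨mem_filtration.2 ⟨fun b => ?_, fun b => ?_⟩, ?_⟩
    · refine apply_apply_eq_zero_of_add (hr.dd_of_eq (zc ^ j) (zc ^ (j + 1) * b) (by ring)
        (by ring)) (huf.1 b) ?_
      rw [LinearMap.smul_apply, show zc ^ (j + 1) * (zc ^ (j + 2) * b) =
        zc ^ (j + 2) * (zc ^ (j + 1) * b) by ring, hker u hu, smul_zero]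
    · rw [pow_succ, mul_assoc]; exact key _
    · have := key 1
      rwa [mul_one] at this
  -- The factor `j + 1/2` is nonzero even for `j = 0`, so the descent reaches the odd fields of
  -- order one.
  obtain ⟨v, hvU, hv0, hvx⟩ := exists_ne_zero_apply_eq_zero U' hne (lExt e zc)
    (lExt d (zc ^ (j + 1))) hU'e hU'x (c := (j : ℂ) + 1 / 2) (fun hc => by
      have := congrArg Complex.re hc
      simp at this
      have h2 : (0 : ℝ) ≤ j := Nat.cast_nonneg j
      linarith)
    (fun u hu => by
      have huf := mem_filtration.1 hu.1
      have := LinearMap.congr_fun (hr.ed_of_eq (f := zc) (g := zc ^ (j + 1)) 1 (zc ^ j)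
        (by ring) (by ring) (F := ((j : ℂ) + 1 / 2) • zc ^ (j + 1) +
          zc ^ (j + 2) * ((j : ℂ) + 1 / 2) • 1) (by
          have e3 : algebraMap ℂ ℂ[T;T⁻¹] (1 / 2) + algebraMap ℂ ℂ[T;T⁻¹] (1 / 2) = 1 := by
            rw [← map_add]; norm_num
          simp only [eulerD_zc, eulerD_zc_pow, smul_eq_mul, Algebra.smul_def, hz,
            map_add, map_natCast, map_one, Nat.cast_add, Nat.cast_one, map_ofNat]
          linear_combination (-1 : ℂ[T;T⁻¹]) * zc ^ (j + 1) * (zc + 1) * e3)) u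
      rw [map_add, LinearMap.add_apply, huf.1, map_smul] at this
      simpa using this)
  refine (Submodule.ne_bot_iff _).2 ⟨v, mem_filtration.2 ⟨fun b => ?_, hker v hvU⟩, hv0⟩
  obtain ⟨c, b, rfl⟩ := exists_eq_const_add b
  have h2 := (mem_filtration.1 hvU.1).1 b
  rw [mul_add, map_add, mul_smul_comm, mul_one, map_smul, LinearMap.add_apply,
    LinearMap.smul_apply, hvx, smul_zero, zero_add, ← mul_assoc, ← pow_succ]
  exact h2

/-- In a nonzero finite-dimensional representation, the odd operators have a common kernel. -/
theorem exists_forall_d_eq_zero [FiniteDimensional ℂ W] [Nontrivial W]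
    (hr : IsotropyRelations e d) : ∃ w : W, w ≠ 0 ∧ ∀ n, d n w = 0 := by
  obtain ⟨N, hN⟩ := hr.exists_lExt_e_eq_zero
  obtain ⟨N', hN'⟩ := hr.exists_lExt_d_eq_zero
  have base : filtration e d (N + N' + 1) ≠ ⊥ := by
    obtain ⟨w, hw⟩ := exists_ne (0 : W)
    refine (Submodule.ne_bot_iff _).2 ⟨w, mem_filtration.2 ⟨fun b => ?_, fun b => ?_⟩, hw⟩
    · rw [hN' _ (by omega)]; rfl
    · rw [hN _ (by omega)]; rfl
  have descend : ∀ n, filtration e d (n + 1) ≠ ⊥ → filtration e d 1 ≠ ⊥ := fun n => by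
    induction n with
    | zero => exact id
    | succ n ih => exact fun h => ih (hr.filtration_descend n h)
  obtain ⟨w, hw, hw0⟩ := (Submodule.ne_bot_iff _).1 (descend _ base)
  refine ⟨w, hw0, fun n => ?_⟩
  obtain ⟨b, hb⟩ := exists_T_eq n
  have h2 := (mem_filtration.1 hw).1 b
  -- Since `T n - 1` vanishes at `t = 1`, the vector `w` does not distinguish `d n` from `d 0`,
  -- which is zero.
  have h3 : lExt d (T n) w = lExt d (T 0) w := by
    rw [hb, map_add, T_zero, LinearMap.add_apply, ← pow_one zc, h2, add_zero]
  rwa [lExt_T, lExt_T, hr.d_zero, LinearMap.zero_apply] at h3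

end IsotropyRelations

/-! ### The operators of the basis vectors on a module -/

namespace ASModule

variable {M : Type*} [AddCommGroup M] [Module ℂ M] (ρ : ASModule M)

/-- The operator `L_m`. -/
def opL (m : ℤ) : Module.End ℂ M := ρ.act (Lgen m, 0)

/-- The operator `G_m`. -/
def opG (m : ℤ) : Module.End ℂ M := ρ.act (Ggen m, 0)

/-- The operator `t^i`. -/
def opT (i : ℤ) : Module.End ℂ M := ρ.act (0, t i)

/-- The operator `ξ`. -/
def opX : Module.End ℂ M := ρ.act (0, xi)

lemma mem_gr_left {i : ZMod 2} {x : SBar} (hx : x ∈ sBar.gr i) :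
    ((x, 0) : SBar × A) ∈ sTilde.gr i := ⟨hx, zero_mem _⟩

lemma mem_gr_right {i : ZMod 2} {a : A} (ha : a ∈ aGr i) :
    ((0, a) : SBar × A) ∈ sTilde.gr i := ⟨zero_mem _, ha⟩

lemma xi_eq : xi = t 0 * xi := by rw [t_zero, one_mul]

lemma xi_mem : xi ∈ aGr 1 := xi_eq ▸ txi_mem 0

lemma act_left_right {i j : ZMod 2} {x : SBar} {a : A} (hx : x ∈ sBar.gr i) (ha : a ∈ aGr j)
    (v : M) : ρ.act (x, 0) (ρ.act (0, a) v) =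
      ρ.act (0, circ x a) v + sgn i j • ρ.act (0, a) (ρ.act (x, 0) v) := by
  have h := ρ.act_bracket i j _ _ v (mem_gr_left hx) (mem_gr_right ha)
  have e : sTilde.bracket (x, 0) (0, a) = (0, circ x a) := by
    change (sBar.bracket x 0, circ x a - signedAct sBar aModule 0 0) = _
    simp
  rw [e] at h
  rw [h, sub_add_cancel]

lemma act_left_left {i j : ZMod 2} {x y : SBar} (hx : x ∈ sBar.gr i) (hy : y ∈ sBar.gr j)
    (v : M) : ρ.act (x, 0) (ρ.act (y, 0) v) =
      ρ.act (sBarBracket x y, 0) v + sgn i j • ρ.act (y, 0) (ρ.act (x, 0) v) := by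
  have h := ρ.act_bracket i j _ _ v (mem_gr_left hx) (mem_gr_left hy)
  have e : sTilde.bracket (x, 0) (y, 0) = (sBarBracket x y, 0) := by
    change (sBar.bracket x y, aModule.act x 0 - signedAct sBar aModule 0 y) = _
    simp
    rfl
  rw [e] at h
  rw [h, sub_add_cancel]

lemma act_smul_left (c : ℂ) (x : SBar) (v : M) : ρ.act (c • x, 0) v = c • ρ.act (x, 0) v := by
  rw [← LinearMap.smul_apply, ← map_smul, Prod.smul_mk, smul_zero]

lemma act_smul_right (c : ℂ) (a : A) (v : M) : ρ.act (0, c • a) v = c • ρ.act (0, a) v := by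
  rw [← LinearMap.smul_apply, ← map_smul, Prod.smul_mk, smul_zero]

lemma opT_zero (v : M) : ρ.opT 0 v = v := by rw [opT, t_zero, ρ.act_one]

lemma opT_opT (i j : ℤ) (v : M) : ρ.opT i (ρ.opT j v) = ρ.opT (i + j) v := by
  rw [opT, opT, opT, ← ρ.act_mul, t_mul_t]

lemma act_txi (i : ℤ) (v : M) : ρ.act (0, t i * xi) v = ρ.opT i (ρ.opX v) := ρ.act_mul _ _ _

lemma opX_opT (i : ℤ) (v : M) : ρ.opX (ρ.opT i v) = ρ.opT i (ρ.opX v) := by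
  rw [opT, opX, ← ρ.act_mul, ← ρ.act_mul, mul_comm]

lemma opX_opX (v : M) : ρ.opX (ρ.opX v) = 0 := by
  rw [opX, ← ρ.act_mul, xi_mul_xi, ← Prod.zero_eq_mk, map_zero, LinearMap.zero_apply]

lemma opL_opT (m i : ℤ) (v : M) :
    ρ.opL m (ρ.opT i v) = ρ.opT i (ρ.opL m v) + (i : ℂ) • ρ.opT (m + i) v := by
  have h := ρ.act_left_right (Lgen_mem m) (t_mem i) v
  rw [circ_eq, gamma_L_t, act_smul_right] at h
  rw [opL, opT, h]
  simp [sgn, opT, add_comm]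

lemma opL_opX (m : ℤ) (v : M) :
    ρ.opL m (ρ.opX v) = ρ.opX (ρ.opL m v) + ((m : ℂ) / 2) • ρ.opT m (ρ.opX v) := by
  have h := ρ.act_left_right (Lgen_mem m) xi_mem v
  have e : circ (Lgen m) xi = ((m : ℂ) / 2) • (t m * xi) := by
    rw [xi_eq, circ_eq, gamma_L_txi, add_zero, ← xi_eq]
    congr 1
    simp; ring
  rw [e, act_smul_right, act_txi] at h
  rw [opL, opX, h]
  simp [sgn, opX, add_comm]

lemma opG_opT (m i : ℤ) (v : M) :
    ρ.opG m (ρ.opT i v) = ρ.opT i (ρ.opG m v) + (i : ℂ) • ρ.opT (m + i) (ρ.opX v) := by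
  have h := ρ.act_left_right (Ggen_mem m) (t_mem i) v
  rw [circ_eq, gamma_G_t, act_smul_right, act_txi] at h
  rw [opG, opT, h]
  simp [sgn, opT, add_comm]

lemma opG_opX (m : ℤ) (v : M) : ρ.opG m (ρ.opX v) = -ρ.opX (ρ.opG m v) - ρ.opT m v := by
  have h := ρ.act_left_right (Ggen_mem m) xi_mem v
  have e : circ (Ggen m) xi = (-1 : ℂ) • t m := by
    rw [xi_eq, circ_eq, gamma_G_txi, add_zero, neg_one_smul]
  rw [e, act_smul_right] at h
  rw [opG, opX, h]
  simp [sgn, opT, opX]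
  abel

lemma opL_opL (m n : ℤ) (v : M) :
    ρ.opL m (ρ.opL n v) = ρ.opL n (ρ.opL m v) + ((n : ℂ) - m) • ρ.opL (m + n) v := by
  have h := ρ.act_left_left (Lgen_mem m) (Lgen_mem n) v
  rw [sBar_LL, act_smul_left] at h
  rw [opL, opL, h]
  simp [sgn, opL, add_comm]

lemma opL_opG (m n : ℤ) (v : M) :
    ρ.opL m (ρ.opG n v) = ρ.opG n (ρ.opL m v) + ((n : ℂ) - m / 2) • ρ.opG (m + n) v := by
  have h := ρ.act_left_left (Lgen_mem m) (Ggen_mem n) v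
  rw [sBar_LG, act_smul_left] at h
  rw [opL, opG, h]
  simp [sgn, opL, opG, add_comm]

lemma opG_opG (m n : ℤ) (v : M) :
    ρ.opG m (ρ.opG n v) = -ρ.opG n (ρ.opG m v) - (2 : ℂ) • ρ.opL (m + n) v := by
  have h := ρ.act_left_left (Ggen_mem m) (Ggen_mem n) v
  rw [sBar_GG, act_smul_left] at h
  rw [opG, opG, h]
  simp [sgn, opL, opG]
  abel

/-- The operator `t^{-m} L_m - L_0`. -/
def opE (m : ℤ) : Module.End ℂ M := ρ.opT (-m) * ρ.opL m - ρ.opL 0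

/-- The operator `t^{-m} G_m - G_0`. -/
def opD (m : ℤ) : Module.End ℂ M := ρ.opT (-m) * ρ.opG m - ρ.opG 0

lemma opL_apply (m : ℤ) (v : M) : ρ.opL m v = ρ.opT m (ρ.opE m v) + ρ.opT m (ρ.opL 0 v) := by
  simp [opE, opT_opT, opT_zero]

lemma opG_apply (m : ℤ) (v : M) : ρ.opG m v = ρ.opT m (ρ.opD m v) + ρ.opT m (ρ.opG 0 v) := by
  simp [opD, opT_opT, opT_zero]

/-- The space of the vectors of weight `lam` annihilated by `ξ`. -/
def singular (lam : ℂ) : Submodule ℂ M := ρ.weightSpace lam ⊓ LinearMap.ker ρ.opX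

/-! ### The isotropy action on singular vectors -/

variable {ρ} {lam : ℂ}

lemma mem_singular {w : M} : w ∈ ρ.singular lam ↔ ρ.opL 0 w = lam • w ∧ ρ.opX w = 0 := by
  simp [singular, weightSpace, opL]

lemma opE_mem_singular (m : ℤ) {w : M} (hw : w ∈ ρ.singular lam) :
    ρ.opE m w ∈ ρ.singular lam := by
  rw [mem_singular] at hw ⊢
  obtain ⟨h0, hX⟩ := hw
  have hx := ρ.opL_opX m w
  rw [hX, map_zero, map_zero, smul_zero, add_zero] at hx
  have hl := ρ.opL_opL 0 m w
  rw [h0, map_smul, zero_add] at hl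
  constructor
  · simp only [opE, LinearMap.sub_apply, Module.End.mul_apply, map_sub, opL_opT, h0, map_smul, hl,
      map_add, zero_add, Int.cast_neg, Int.cast_zero, sub_zero]
    module
  · simp [opE, opX_opT, ← hx, h0, hX]

/-- Subtracting `G_0` is essential here: `ξ t^{-m} G_m w = -w` for every `m`, so neither term alone
stays in the kernel of `ξ`, but the difference does. -/
lemma opD_mem_singular (m : ℤ) {w : M} (hw : w ∈ ρ.singular lam) :
    ρ.opD m w ∈ ρ.singular lam := by
  rw [mem_singular] at hw ⊢
  obtain ⟨h0, hX⟩ := hw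
  have hg : ∀ m, ρ.opX (ρ.opG m w) = -ρ.opT m w := fun m => by
    have := ρ.opG_opX m w
    rw [hX, map_zero, eq_comm, sub_eq_zero] at this
    rw [← this, neg_neg]
  have hl : ∀ m, ρ.opL 0 (ρ.opG m w) = lam • ρ.opG m w + (m : ℂ) • ρ.opG m w := fun m => by
    have := ρ.opL_opG 0 m w
    simpa [h0] using this
  constructor
  · simp only [opD, LinearMap.sub_apply, Module.End.mul_apply, map_sub, opL_opT, hl, map_smul,
      map_add, zero_add, Int.cast_neg, Int.cast_zero, sub_zero]
    module
  · simp [opD, opX_opT, hg, opT_opT]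

/-- The restriction of `opE` to the singular vectors. -/
def resE (ρ : ASModule M) (lam : ℂ) (m : ℤ) : Module.End ℂ (ρ.singular lam) :=
  (ρ.opE m).restrict fun _ => opE_mem_singular m

/-- The restriction of `opD` to the singular vectors. -/
def resD (ρ : ASModule M) (lam : ℂ) (m : ℤ) : Module.End ℂ (ρ.singular lam) :=
  (ρ.opD m).restrict fun _ => opD_mem_singular m

lemma opX_opG_of_mem (m : ℤ) {w : M} (hw : w ∈ ρ.singular lam) :
    ρ.opX (ρ.opG m w) = -ρ.opT m w := by
  have := ρ.opG_opX m w
  rw [(mem_singular.1 hw).2, map_zero, eq_comm, sub_eq_zero] at this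
  rw [← this, neg_neg]

lemma opX_opL_of_mem (m : ℤ) {w : M} (hw : w ∈ ρ.singular lam) : ρ.opX (ρ.opL m w) = 0 := by
  have := ρ.opL_opX m w
  rwa [(mem_singular.1 hw).2, map_zero, map_zero, smul_zero, add_zero, eq_comm] at this

/-- Moving powers of `t` to the left through `L_m` and `G_m` produces correction terms. On singular
vectors they simplify because `L_0` is the scalar `lam`, `ξ L_m w = 0` and `ξ G_m w = -t^m w`. -/
lemma isotropyRelations (ρ : ASModule M) (lam : ℂ) :
    IsotropyRelations (ρ.resE lam) (ρ.resD lam) where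
  e_zero := by ext w; simp [resE, opE, opT_zero]
  d_zero := by ext w; simp [resD, opD, opT_zero]
  ee m n := by
    ext w
    obtain ⟨h0, -⟩ := mem_singular.1 w.2
    have hL : ∀ m, ρ.opL 0 (ρ.opL m w) = lam • ρ.opL m w + (m : ℂ) • ρ.opL m w := fun m => by
      have := ρ.opL_opL 0 m w
      simpa [h0] using this
    have hmn := ρ.opL_opL m n w
    simp only [resE, opE, LinearMap.sub_apply, LinearMap.add_apply, Module.End.mul_apply, map_sub,
      LinearMap.smul_apply, LinearMap.restrict_apply, Submodule.coe_sub, Submodule.coe_add,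
      Submodule.coe_smul, opL_opT, h0, map_smul, hL, hmn, map_add, opT_opT]
    ring_nf
    push_cast
    module
  ed m n := by
    ext w
    obtain ⟨h0, hx⟩ := mem_singular.1 w.2
    have hG : ∀ m, ρ.opL 0 (ρ.opG m w) = lam • ρ.opG m w + (m : ℂ) • ρ.opG m w := fun m => by
      have := ρ.opL_opG 0 m w
      simpa [h0] using this
    have hmn := ρ.opL_opG m n w
    have hm0 := ρ.opL_opG m 0 w
    simp only [resE, resD, opE, opD, LinearMap.sub_apply, LinearMap.add_apply,
      Module.End.mul_apply, map_sub, LinearMap.smul_apply, LinearMap.restrict_apply,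
      Submodule.coe_sub, Submodule.coe_add, Submodule.coe_smul, opL_opT, opG_opT,
      opX_opL_of_mem _ w.2, h0, map_smul, hG, hmn, hm0, map_add, opT_opT, map_zero]
    ring_nf
    push_cast
    module
  dd m n := by
    ext w
    obtain ⟨h0, hx⟩ := mem_singular.1 w.2
    have hmn := ρ.opG_opG m n w
    have hm0 := ρ.opG_opG m 0 w
    have hn0 := ρ.opG_opG n 0 w
    have h00 := ρ.opG_opG 0 0 w
    rw [add_zero] at h00
    simp only [resE, resD, opE, opD, LinearMap.sub_apply, LinearMap.add_apply,
      Module.End.mul_apply, map_sub, LinearMap.smul_apply, LinearMap.restrict_apply,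
      Submodule.coe_sub, Submodule.coe_add, Submodule.coe_smul, opG_opT,
      opX_opG_of_mem _ w.2, hmn, hm0, hn0, map_smul, map_add, opT_opT, map_neg]
    ring_nf
    -- What is left is `2 G_0² = -2 L_0`, from the subtracted terms `G_0` and `L_0`.
    linear_combination (norm := module) h00

end ASModule

/-! ### Extremal vectors -/

lemma Superspace.exists_eq_add {V : Type*} [AddCommGroup V] [Module ℂ V] (S : Superspace V)
    (v : V) : ∃ v₀ ∈ S.gr 0, ∃ v₁ ∈ S.gr 1, v = v₀ + v₁ := by
  obtain ⟨y, hy, z, hz, h⟩ := Submodule.mem_sup.1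
    (S.isCompl.sup_eq_top.symm ▸ Submodule.mem_top : v ∈ S.gr 0 ⊔ S.gr 1)
  exact ⟨y, hy, z, hz, h.symm⟩

/-- The homogeneous components of a vector annihilated by a homogeneous operator are annihilated
by it. -/
lemma Superspace.apply_eq_zero_of_add {V : Type*} [AddCommGroup V] [Module ℂ V]
    (S : Superspace V) {Y : Module.End ℂ V} {p : ZMod 2}
    (hY : ∀ j, ∀ v ∈ S.gr j, Y v ∈ S.gr (p + j)) {v₀ v₁ : V} (h₀ : v₀ ∈ S.gr 0)
    (h₁ : v₁ ∈ S.gr 1) (h : Y (v₀ + v₁) = 0) : Y v₀ = 0 ∧ Y v₁ = 0 := by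
  have hdisj : Disjoint (S.gr (p + 0)) (S.gr (p + 1)) := by
    have hz2 : ∀ m : ZMod 2, m = 0 ∨ m = 1 := by decide
    rcases hz2 p with rfl | rfl
    · exact S.isCompl.disjoint
    · exact S.isCompl.disjoint.symm
  rw [map_add] at h
  have h0 : Y v₀ = 0 := Submodule.disjoint_def.1 hdisj _ (hY _ _ h₀)
    (eq_neg_of_add_eq_zero_left h ▸ neg_mem (hY _ _ h₁))
  exact ⟨h0, by simpa [h0] using h⟩

namespace ASModule

variable {M : Type*} [AddCommGroup M] [Module ℂ M] (ρ : ASModule M)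

lemma opL_mem_gr (m : ℤ) (j : ZMod 2) (v : M) (hv : v ∈ ρ.gr j) : ρ.opL m v ∈ ρ.gr (0 + j) :=
  ρ.act_mem _ _ _ _ (mem_gr_left (Lgen_mem m)) hv

lemma opG_mem_gr (m : ℤ) (j : ZMod 2) (v : M) (hv : v ∈ ρ.gr j) : ρ.opG m v ∈ ρ.gr (1 + j) :=
  ρ.act_mem _ _ _ _ (mem_gr_left (Ggen_mem m)) hv

lemma opT_mem_gr (i : ℤ) (j : ZMod 2) (v : M) (hv : v ∈ ρ.gr j) : ρ.opT i v ∈ ρ.gr (0 + j) :=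
  ρ.act_mem _ _ _ _ (mem_gr_right (t_mem i)) hv

lemma opX_mem_gr (j : ZMod 2) (v : M) (hv : v ∈ ρ.gr j) : ρ.opX v ∈ ρ.gr (1 + j) :=
  ρ.act_mem _ _ _ _ (mem_gr_right xi_mem) hv

lemma opE_mem_gr (m : ℤ) (j : ZMod 2) (v : M) (hv : v ∈ ρ.gr j) : ρ.opE m v ∈ ρ.gr (0 + j) := by
  have h := ρ.opT_mem_gr (-m) _ _ (ρ.opL_mem_gr m j v hv)
  rw [zero_add] at h
  exact sub_mem h (ρ.opL_mem_gr 0 j v hv)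

lemma opD_mem_gr (m : ℤ) (j : ZMod 2) (v : M) (hv : v ∈ ρ.gr j) : ρ.opD m v ∈ ρ.gr (1 + j) := by
  have h := ρ.opT_mem_gr (-m) _ _ (ρ.opG_mem_gr m j v hv)
  rw [zero_add] at h
  exact sub_mem h (ρ.opG_mem_gr 0 j v hv)

lemma sub_smul_mem_gr (lam : ℂ) (j : ZMod 2) (v : M) (hv : v ∈ ρ.gr j) :
    (ρ.opL 0 - lam • (1 : Module.End ℂ M)) v ∈ ρ.gr (0 + j) := by
  have h := ρ.opL_mem_gr 0 j v hv
  rw [zero_add] at h ⊢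
  exact sub_mem h (Submodule.smul_mem _ _ hv)

/-- The singular vectors of parity `i` that are annihilated by the operators `t^{-n} G_n - G_0`. -/
def extremal (lam : ℂ) (i : ZMod 2) : Submodule ℂ M :=
  (ρ.singular lam ⊓ ρ.gr i) ⊓ ⨅ n, LinearMap.ker (ρ.opD n)

variable {ρ} {lam : ℂ} {i : ZMod 2}

lemma mem_extremal {w : M} :
    w ∈ ρ.extremal lam i ↔ (w ∈ ρ.singular lam ∧ w ∈ ρ.gr i) ∧ ∀ n, ρ.opD n w = 0 := by
  simp [extremal]

/-! ### Existence of extremal vectors -/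

lemma exists_singular_ne_bot [Nontrivial M] (hcusp : ρ.IsCuspidal) :
    ∃ lam, ρ.singular lam ≠ ⊥ ∧ FiniteDimensional ℂ (ρ.singular lam) := by
  obtain ⟨hw, N, hN⟩ := hcusp
  obtain ⟨lam, hlam⟩ : ∃ lam, ρ.weightSpace lam ≠ ⊥ := by
    by_contra! h
    rw [IsWeight] at hw
    simp only [h, iSup_bot] at hw
    exact bot_ne_top hw
  have hfin : FiniteDimensional ℂ (ρ.weightSpace lam) :=
    Module.rank_lt_aleph0_iff.1 ((hN lam hlam).trans (Cardinal.natCast_lt_aleph0))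
  refine ⟨lam, ?_, Submodule.finiteDimensional_inf_left _ _⟩
  obtain ⟨v, hv, hv0⟩ := (Submodule.ne_bot_iff _).1 hlam
  have hv' : ρ.opL 0 v = lam • v := Module.End.mem_eigenspace_iff.1 hv
  rw [Submodule.ne_bot_iff]
  by_cases hX : ρ.opX v = 0
  · exact ⟨v, mem_singular.2 ⟨hv', hX⟩, hv0⟩
  · refine ⟨ρ.opX v, mem_singular.2 ⟨?_, ρ.opX_opX v⟩, hX⟩
    simp [ρ.opL_opX, hv']

/-- All conditions on `w` are the vanishing of homogeneous operators, namely `L_0 - lam`, `ξ` and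
the `opD n`. Both homogeneous components of `w` therefore satisfy them, and one component is
nonzero. -/
lemma exists_extremal_ne_bot (h : ρ.singular lam ≠ ⊥)
    (hfin : FiniteDimensional ℂ (ρ.singular lam)) : ∃ i, ρ.extremal lam i ≠ ⊥ := by
  have : Nontrivial (ρ.singular lam) := Submodule.nontrivial_iff_ne_bot.2 h
  obtain ⟨⟨w, hw⟩, hw0, hD⟩ := (isotropyRelations ρ lam).exists_forall_d_eq_zero
  have hD' : ∀ n, ρ.opD n w = 0 := fun n => by simpa [resD, Subtype.ext_iff] using hD n
  obtain ⟨hL, hX⟩ := mem_singular.1 hw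
  obtain ⟨v₀, h₀, v₁, h₁, rfl⟩ := ρ.exists_eq_add w
  have hL' := ρ.apply_eq_zero_of_add (ρ.sub_smul_mem_gr lam) h₀ h₁
    (by simpa [sub_eq_zero] using hL)
  have hX' := ρ.apply_eq_zero_of_add ρ.opX_mem_gr h₀ h₁ hX
  have hDD := fun n => ρ.apply_eq_zero_of_add (ρ.opD_mem_gr n) h₀ h₁ (hD' n)
  by_cases hv : v₀ = 0
  · refine ⟨1, (Submodule.ne_bot_iff _).2 ⟨v₁, mem_extremal.2
      ⟨⟨mem_singular.2 ⟨by simpa [sub_eq_zero] using hL'.2, hX'.2⟩, h₁⟩, fun n => (hDD n).2⟩, ?_⟩⟩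
    rintro rfl
    exact hw0 (by ext; simpa using hv)
  · exact ⟨0, (Submodule.ne_bot_iff _).2 ⟨v₀, mem_extremal.2
      ⟨⟨mem_singular.2 ⟨by simpa [sub_eq_zero] using hL'.1, hX'.1⟩, h₀⟩, fun n => (hDD n).1⟩, hv⟩⟩

/-- The commutator of an `opE` and an `opD` is a combination of `opD`s, so the common kernel of the
`opD`s is stable. -/
lemma opE_mem_extremal (m : ℤ) {w : M} (hw : w ∈ ρ.extremal lam i) :
    ρ.opE m w ∈ ρ.extremal lam i := by
  obtain ⟨⟨hs, hi⟩, hD⟩ := mem_extremal.1 hw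
  refine mem_extremal.2 ⟨⟨opE_mem_singular m hs, ?_⟩, fun n => ?_⟩
  · simpa using ρ.opE_mem_gr m i w hi
  · have h := congrArg Subtype.val
      (LinearMap.congr_fun ((isotropyRelations ρ lam).ed m n) ⟨w, hs⟩)
    simpa [resE, resD, hD] using h

/-- The anticommutator of `opD m` and `opD n` kills `w`, and it equals `-2` times the defect of
additivity. -/
lemma opE_add_of_mem (m n : ℤ) {w : M} (hw : w ∈ ρ.extremal lam i) :
    ρ.opE (m + n) w = ρ.opE m w + ρ.opE n w := by
  obtain ⟨⟨hs, hi⟩, hD⟩ := mem_extremal.1 hw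
  have h := congrArg Subtype.val (LinearMap.congr_fun ((isotropyRelations ρ lam).dd m n) ⟨w, hs⟩)
  simp only [resE, resD, LinearMap.add_apply, Module.End.mul_apply, LinearMap.restrict_apply,
    LinearMap.smul_apply, LinearMap.sub_apply, Submodule.coe_add, Submodule.coe_smul,
    Submodule.coe_sub, hD, map_zero, add_zero] at h
  have h' := (smul_eq_zero.1 h.symm).resolve_left (by norm_num)
  rw [sub_sub, sub_eq_zero] at h'
  exact h'

/-- A nonzero cuspidal module contains a homogeneous vector that behaves like `ξ ⊗ u`. -/
lemma exists_extremal_eigenvector [Nontrivial M] (hcusp : ρ.IsCuspidal) :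
    ∃ (lam β : ℂ) (i : ZMod 2) (w : M), w ≠ 0 ∧ w ∈ ρ.gr i ∧ ρ.opX w = 0 ∧
      (∀ m, ρ.opG m w = ρ.opT m (ρ.opG 0 w)) ∧
      ∀ m, ρ.opL m w = (lam + m * β) • ρ.opT m w := by
  obtain ⟨lam, hne, hfin⟩ := exists_singular_ne_bot hcusp
  obtain ⟨i, hi⟩ := exists_extremal_ne_bot hne hfin
  have : Nontrivial (ρ.extremal lam i) := Submodule.nontrivial_iff_ne_bot.2 hi
  have : FiniteDimensional ℂ (ρ.extremal lam i) :=
    Submodule.finiteDimensional_of_le (inf_le_left.trans inf_le_left : _ ≤ ρ.singular lam)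
  obtain ⟨β, hβ⟩ := Module.End.exists_eigenvalue
    ((ρ.opE 1).restrict fun _ => opE_mem_extremal (ρ := ρ) (lam := lam) (i := i) 1)
  obtain ⟨⟨w, hw⟩, hw1, hw0⟩ := hβ.exists_hasEigenvector
  have h1 : ρ.opE 1 w = β • w := by
    have := Module.End.mem_eigenspace_iff.1 hw1
    simpa [Subtype.ext_iff] using this
  obtain ⟨⟨hs, hgr⟩, hD⟩ := mem_extremal.1 hw
  obtain ⟨hL, hX⟩ := mem_singular.1 hs
  refine ⟨lam, β, i, w, by simpa using hw0, hgr, hX, fun m => ?_, fun m => ?_⟩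
  · rw [ρ.opG_apply m, hD, map_zero, zero_add]
  -- Additivity in `m` reduces every `opE m w` to `m` times `opE 1 w = β w`.
  · let f : ℤ →+ M := AddMonoidHom.mk' (fun m => ρ.opE m w) fun m n => opE_add_of_mem m n hw
    have hf : ρ.opE m w = ((m : ℂ) * β) • w := by
      have := map_zsmul f m 1
      rw [zsmul_one, Int.cast_id] at this
      rw [mul_smul, ← h1, Int.cast_smul_eq_zsmul]
      exact this
    rw [ρ.opL_apply, hf, hL, map_smul, map_smul]
    module

/-! ### The comparison with `Γ(λ, b)` -/

/-- The linear map `y ⊗ u ↦ y v`. -/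
def ofVector (ρ : ASModule M) (v : M) : A →ₗ[ℂ] M :=
  (LinearMap.applyₗ v).comp (ρ.act.comp (LinearMap.inr ℂ SBar A))

lemma ofVector_apply (v : M) (a : A) : ρ.ofVector v a = ρ.act (0, a) v := rfl

lemma ofVector_t (v : M) (k : ℤ) : ρ.ofVector v (t k) = ρ.opT k v := rfl

lemma ofVector_txi (v : M) (k : ℤ) : ρ.ofVector v (t k * xi) = ρ.opT k (ρ.opX v) := ρ.act_txi _ _

/-- The vectors `t^k v` are nonzero, since `t^k` is invertible, and have the distinct weights `lam +
k`. -/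
lemma lExt_opT_injective {v : M} (hv0 : v ≠ 0) (hv : ρ.opL 0 v = lam • v) :
    Function.Injective (lExt fun k => ρ.opT k v) := by
  have hli : LinearIndependent ℂ fun k : ℤ => ρ.opT k v := by
    refine Module.End.eigenvectors_linearIndependent' (ρ.opL 0) (fun k : ℤ => lam + k)
      (fun a b hab => by simpa using hab) _ fun k => ⟨?_, fun h => hv0 ?_⟩
    · rw [Module.End.mem_eigenspace_iff, ρ.opL_opT, hv, map_smul, zero_add]
      module
    · have := congrArg (ρ.opT (-k)) h
      rwa [opT_opT, neg_add_cancel, opT_zero, map_zero] at this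
  exact Function.Injective.comp (g := Finsupp.linearCombination ℂ fun k => ρ.opT k v) hli
    (AddMonoidAlgebra.coeffLinearEquiv ℂ).injective

lemma ofVector_eq (v : M) (a : A) : ρ.ofVector v a =
    lExt (fun k => ρ.opT k v) (aFst a) + lExt (fun k => ρ.opT k (ρ.opX v)) (aSnd a) := by
  induction a using a_induction with
  | h0 => simp
  | hadd x y hx hy => simp only [map_add, hx, hy]; abel
  | hsmul c x hx => simp only [map_smul, hx, smul_add]
  | ht k =>
    rw [ofVector_t, show aFst (t k) = LaurentPolynomial.T k from rfl,
      show aSnd (t k) = 0 from rfl, lExt_T, map_zero, add_zero]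
  | hx k =>
    rw [ofVector_txi, t_mul_xi,
      show aFst (TrivSqZeroExt.inr (LaurentPolynomial.T k) : A) = 0 from rfl,
      show aSnd (TrivSqZeroExt.inr (LaurentPolynomial.T k) : A) = LaurentPolynomial.T k from rfl,
      lExt_T, map_zero, zero_add]

/-- Applying `ξ` to `(p + q ξ) v = 0` leaves `p ξ v = 0`, hence `p = 0` and then `q ξ v = 0`. Only
`ξ v` has to be a nonzero weight vector. -/
lemma ofVector_injective {v : M} (hv0 : ρ.opX v ≠ 0)
    (hXv : ρ.opL 0 (ρ.opX v) = lam • ρ.opX v) : Function.Injective (ρ.ofVector v) := by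
  rw [injective_iff_map_eq_zero]
  intro a ha
  have hX : ∀ p, ρ.opX (lExt (fun k => ρ.opT k v) p) = lExt (fun k => ρ.opT k (ρ.opX v)) p := by
    intro p
    induction p using laurent_induction with
    | h0 => simp
    | hadd f g hf hg => simp only [map_add, hf, hg]
    | hsmul c f hf => simp only [map_smul, hf]
    | hT n => simp only [lExt_T, opX_opT]
  have hXX : ∀ p, ρ.opX (lExt (fun k => ρ.opT k (ρ.opX v)) p) = 0 := fun p => by
    rw [← hX, opX_opX]
  rw [ofVector_eq] at ha
  have h1 := congrArg ρ.opX ha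
  rw [map_add, hX, hXX, add_zero, map_zero] at h1
  have h2 : aFst a = 0 := lExt_opT_injective hv0 hXv (by rw [h1, map_zero])
  rw [h2, map_zero, zero_add] at ha
  have h3 : aSnd a = 0 := lExt_opT_injective hv0 hXv (by rw [ha, map_zero])
  exact TrivSqZeroExt.ext h2 h3

/-- The commutation rules with `t^n` propagate the action from `u` and `ξ u` to all of `A u`, so the
four families of formulas suffice. -/
lemma ofVector_gammaAct {b : ℂ} {u : M}
    (hLu : ∀ m, ρ.opL m u = (lam + m * b) • ρ.opT m u)
    (hGu : ∀ m, ρ.opG m u = (lam + 2 * m * b) • ρ.opT m (ρ.opX u))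
    (hLw : ∀ m, ρ.opL m (ρ.opX u) = (lam + m * (b + 1 / 2)) • ρ.opT m (ρ.opX u))
    (hGw : ∀ m, ρ.opG m (ρ.opX u) = -ρ.opT m u) (x : SBar) (y : A) :
    ρ.ofVector u (gammaAct lam b x y) = ρ.act (x, 0) (ρ.ofVector u y) := by
  induction x using Finsupp.induction_linear with
  | zero => simp [← Prod.zero_eq_mk]
  | add x x' hx hx' =>
    rw [map_add, LinearMap.add_apply, map_add, hx, hx', ← LinearMap.add_apply, ← map_add,
      Prod.mk_add_mk, add_zero]
  | single k c =>
    have hc : (Finsupp.single k c : SBar) = c • Finsupp.single k 1 := by simp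
    rw [hc, map_smul, LinearMap.smul_apply, map_smul, act_smul_left]
    congr 1
    induction y using a_induction with
    | h0 => simp
    | hadd x y hx hy => simp only [map_add, hx, hy]
    | hsmul c x hx => simp only [map_smul, hx]
    | ht n =>
      rw [ofVector_t]
      rcases k with m | m
      · change ρ.ofVector u (gammaAct lam b (Lgen m) (t n)) = ρ.opL m (ρ.opT n u)
        rw [gamma_L_t, map_smul, ofVector_t, opL_opT, hLu, map_smul, opT_opT, add_comm n m]
        module
      · change ρ.ofVector u (gammaAct lam b (Ggen m) (t n)) = ρ.opG m (ρ.opT n u)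
        rw [gamma_G_t, map_smul, ofVector_txi, opG_opT, hGu, map_smul, opT_opT, add_comm n m]
        module
    | hx n =>
      rw [ofVector_txi]
      rcases k with m | m
      · change ρ.ofVector u (gammaAct lam b (Lgen m) (t n * xi)) = ρ.opL m (ρ.opT n (ρ.opX u))
        rw [gamma_L_txi, map_smul, ofVector_txi, opL_opT, hLw, map_smul, opT_opT, add_comm n m]
        module
      · change ρ.ofVector u (gammaAct lam b (Ggen m) (t n * xi)) = ρ.opG m (ρ.opT n (ρ.opX u))
        rw [gamma_G_txi, map_neg, ofVector_t, opG_opT, hGw, map_neg, opT_opT, add_comm n m,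
          opX_opX, map_zero, smul_zero, add_zero]

/-- The map `y ↦ y u` is injective by weights. Its image is a graded submodule containing `ξ u ≠ 0`,
hence everything. -/
lemma isIsomorphic_Gamma (hsimple : ρ.IsSimple) {b : ℂ} {u : M} {ε : ZMod 2} (hu : u ∈ ρ.gr ε)
    (hXu : ρ.opX u ≠ 0) (hLu : ∀ m, ρ.opL m u = (lam + m * b) • ρ.opT m u)
    (hGu : ∀ m, ρ.opG m u = (lam + 2 * m * b) • ρ.opT m (ρ.opX u))
    (hLw : ∀ m, ρ.opL m (ρ.opX u) = (lam + m * (b + 1 / 2)) • ρ.opT m (ρ.opX u))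
    (hGw : ∀ m, ρ.opG m (ρ.opX u) = -ρ.opT m u) :
    ρ.toSuperModule.IsIsomorphic (Gamma lam b ε).toSuperModule := by
  have hgr : ∀ j, ∀ a ∈ aGr (j - ε), ρ.ofVector u a ∈ ρ.gr j := fun j a ha => by
    have := ρ.act_mem _ _ _ _ (mem_gr_right ha) hu
    rwa [sub_add_cancel] at this
  have hact : ∀ x y, ρ.ofVector u ((Gamma lam b ε).act x y) = ρ.act x (ρ.ofVector u y) := by
    rintro ⟨s, a⟩ y
    have h1 : (Gamma lam b ε).act (s, a) y = gammaAct lam b s y + a * y := rfl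
    have h2 : ((s, a) : SBar × A) = (s, 0) + (0, a) := by simp
    rw [h1, map_add, ofVector_gammaAct hLu hGu hLw hGw, h2, map_add ρ.act, LinearMap.add_apply,
      ofVector_apply, ofVector_apply, ρ.act_mul]
  have hinj : Function.Injective (ρ.ofVector u) := ofVector_injective hXu
    (by simpa [opT_zero] using hLw 0)
  have hz2 : ∀ m : ZMod 2, m = 0 ∨ m = 1 := by decide
  have hsurj : LinearMap.range (ρ.ofVector u) = ⊤ := by
    refine (hsimple.2 _ ?_ (le_antisymm ?_ (sup_le inf_le_left inf_le_left))).resolve_left ?_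
    · rintro x _ ⟨y, rfl⟩
      exact ⟨_, hact x y⟩
    · rintro _ ⟨y, rfl⟩
      obtain ⟨y₀, h₀, y₁, h₁, rfl⟩ := (Gamma lam b ε).exists_eq_add y
      rw [map_add]
      exact add_mem (Submodule.mem_sup_left ⟨⟨y₀, rfl⟩, hgr 0 y₀ h₀⟩)
        (Submodule.mem_sup_right ⟨⟨y₁, rfl⟩, hgr 1 y₁ h₁⟩)
    · intro h
      refine hXu ?_
      have : ρ.ofVector u xi = 0 := by
        rw [← Submodule.mem_bot ℂ, ← h]; exact ⟨xi, rfl⟩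
      exact this
  let f : A ≃ₗ[ℂ] M := LinearEquiv.ofBijective (ρ.ofVector u)
    ⟨hinj, LinearMap.range_eq_top.1 hsurj⟩
  have hne : ∀ i j : ZMod 2, i ≠ j → ∀ v, v ∈ ρ.gr i → v ∈ ρ.gr j → v = 0 := by
    intro i j hij v hi hj
    rcases hz2 i with rfl | rfl <;> rcases hz2 j with rfl | rfl
    · exact absurd rfl hij
    · exact Submodule.disjoint_def.1 ρ.isCompl.disjoint v hi hj
    · exact Submodule.disjoint_def.1 ρ.isCompl.disjoint v hj hi
    · exact absurd rfl hij
  refine ⟨f.symm, fun i v hv => ?_, fun x v => ?_⟩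
  -- The inverse preserves parity because `f` maps the components of `y` to those of `f y`: a
  -- homogeneous image has one zero component, and `f` is injective.
  · obtain ⟨y, rfl⟩ := f.surjective v
    rw [f.symm_apply_apply]
    obtain ⟨y₀, h₀, y₁, h₁, rfl⟩ := (Gamma lam b ε).exists_eq_add y
    have k₀ : f y₀ ∈ ρ.gr 0 := hgr 0 y₀ h₀
    have k₁ : f y₁ ∈ ρ.gr 1 := hgr 1 y₁ h₁
    rw [map_add] at hv
    rcases hz2 i with rfl | rfl
    · have : f y₁ = 0 := hne 0 1 (by decide) _ ((Submodule.add_mem_iff_right _ k₀).1 hv) k₁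
      rwa [f.map_eq_zero_iff.1 this, add_zero]
    · have : f y₀ = 0 := hne 0 1 (by decide) _ k₀ ((Submodule.add_mem_iff_left _ k₁).1 hv)
      rwa [f.map_eq_zero_iff.1 this, zero_add]
  · obtain ⟨y, rfl⟩ := f.surjective v
    rw [f.symm_apply_apply, f.symm_apply_eq]
    exact (hact x y).symm

end ASModule

end Ramond

end

/-! ### From the extremal vector to the classification -/

theorem corollary3p5 {M : Type*} [AddCommGroup M] [Module ℂ M] (ρ : Ramond.ASModule M)
    (hsimple : ρ.IsSimple) (hcusp : ρ.IsCuspidal) :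
    ∃ (lam b : ℂ) (ε : ZMod 2),
      ρ.toSuperModule.IsIsomorphic (Ramond.Gamma lam b ε).toSuperModule := by
  have := hsimple.1
  obtain ⟨lam, β, i, w, hw0, hgr, hX, hG, hL⟩ := Ramond.ASModule.exists_extremal_eigenvector hcusp
  have hGT : ∀ m, ρ.opG 0 (ρ.opT m w) = ρ.opT m (ρ.opG 0 w) := fun m => by
    rw [ρ.opG_opT, hX, map_zero, smul_zero, add_zero]
  have hXG : ρ.opX (ρ.opG 0 w) = -w := by
    have := ρ.opG_opX 0 w
    rw [hX, map_zero, ρ.opT_zero, eq_comm, sub_eq_zero] at this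
    exact neg_eq_iff_eq_neg.1 this
  have hXu : ρ.opX (-ρ.opG 0 w) = w := by rw [map_neg, hXG, neg_neg]
  have hGG : ρ.opG 0 (ρ.opG 0 w) = -(lam • w) := by
    have h1 := ρ.opG_opG 0 0 w
    have h2 := hL 0
    rw [Int.cast_zero, zero_mul, add_zero, ρ.opT_zero] at h2
    rw [add_zero, h2] at h1
    linear_combination (norm := module) (1 / 2 : ℂ) • h1
  -- The sign in `u = -G_0 w` makes `ξ u = w`. As `w` takes the place of `ξ ⊗ u`, its parameter `β`
  -- must be `b + 1/2`, and `u` has the opposite parity.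
  refine ⟨lam, β - 1 / 2, 1 + i, Ramond.ASModule.isIsomorphic_Gamma hsimple
    (u := -ρ.opG 0 w) (neg_mem (ρ.opG_mem_gr 0 i w hgr)) (by rwa [hXu]) (fun m => ?_)
    (fun m => ?_) (fun m => ?_) fun m => ?_⟩
  -- The bracket `[L_m, G_0] = -(m/2) G_m` accounts for the shift from `β` to `β - 1/2`.
  · have h := ρ.opL_opG m 0 w
    rw [add_zero, hL, hG m, map_smul, hGT, Int.cast_zero] at h
    rw [map_neg, map_neg, h]
    module
  -- Here `G_0 t^m G_0 w = -(lam + m) t^m w`, using `G_0² w = -lam w` and `ξ G_0 w = -w`. Together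
  -- with `-2 L_m w` this gives the coefficient `lam + m (2β - 1) = lam + 2mb`.
  · have h := ρ.opG_opG m 0 w
    rw [add_zero, hL, hG m, ρ.opG_opT, hGG, hXG, map_neg, map_neg, map_smul, zero_add] at h
    rw [hXu, map_neg, h]
    module
  · rw [hXu, hL, sub_add_cancel]
  · rw [hXu, hG, map_neg, neg_neg]
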